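/- Let $2<\underline v\le\overline v$ be even integers and let $\overline p\ge \overline v/2+2$ be an integer. Two agents own an object; their values for it, $v_l<v_h$, belong to $\{\underline v,\underline v+2,\dots,\overline v\}$. In the winner-bid auction each agent submits a bid in $\{0,1,\dots,\overline p\}$; a highest bidder receives the object, ties being resolved uniformly at random, and pays his or her bid $p$ to the other agent. An agent with value $v_i$ has utility $v_i-p$ when receiving the object and paying $p$, and utility $p$ when being paid $p$; agents maximize expected utility under complete information. For a profile $\sigma=(\sigma_l,\sigma_h)$ of mixed strategies let $U_i(b\mid\sigma_{-i})$ be agent $i$'s expected utility from bidding $b$ against $\sigma_{-i}$, let $\pi_i(\sigma)$ be agent $i$'s expected payoff and $\pi(\sigma)=(\pi_l(\sigma),\pi_h(\sigma))$. The profile $\sigma$ is *efficient* if $\pi_l(\sigma)+\pi_h(\sigma)=v_h$, and *weakly payoff monotone* if for each agent $i$ and all bids $b,d$, $\sigma_i(b)>\sigma_i(d)$ implies $U_i(b\mid\sigma_{-i})>U_i(d\mid\sigma_{-i})$. An *empirical equilibrium* is a (mixed) Nash equilibrium that is the limit of a sequence of weakly payoff monotone profiles. Let $ES=|v_h/2-v_l/2|$.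 Let $\sigma$ be an efficient (mixed) Nash equilibrium of the winner-bid auction. Then $\pi(\sigma)$ is the payoff profile of some empirical equilibrium of the winner-bid auction if and only if 1. $\pi_h(\sigma)=v_h/2+ES$ when $ES\le 2$; 2. $\pi_h(\sigma)\ge v_h/2+ES/2+v_l/4-1/2$ when $ES>2$ and $v_l\le 3v_h/8$; 3. $\pi_h(\sigma)\ge v_h/2+4ES/5-4/5$ when $ES>2$, $v_l>3v_h/8$ and $v_l<7v_h/12-7/6$; 4. $\pi_h(\sigma)> v_h/2+4ES/5-4/5$ when $ES>2$, $v_l>3v_h/8$ and $v_l\ge 7v_h/12-7/6$. -/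

import Mathlib

open Filter Topology

noncomputable section

namespace PartnershipAuction

/-! ### The environment: two agents, indexed by `Fin 2`, dissolving a partnership -/

/-- The common type space `{vmin, vmin + 2, ..., vmax}`. -/
def typeSpace (vmin vmax : ℕ) : Set ℕ := {x | x ≤ vmax ∧ ∃ k : ℕ, x = vmin + 2 * k}

/-- Amounts of money that can be bid or transferred: `{0, 1, ..., pbar}`. -/
abbrev Bid (pbar : ℕ) : Type := Fin (pbar + 1)

/-- An allocation: the agent who receives the object, and the amount this agent pays to the other. -/
abbrev Allocation (pbar : ℕ) : Type := Fin 2 × Bid pbar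

/-- The quasi-linear utility index of agent `i` at an allocation. -/
def utility {pbar : ℕ} (v : Fin 2 → ℕ) (i : Fin 2) (a : Allocation pbar) : ℝ :=
  if a.1 = i then (v i : ℝ) - ((a.2 : ℕ) : ℝ) else ((a.2 : ℕ) : ℝ)

/-- The equity surplus of a low value `vl` and a high value `vh`. -/
def equitySurplus (vl vh : ℕ) : ℝ := |(vh : ℝ) / 2 - (vl : ℝ) / 2|

/-! ### The winner-bid auction -/

/-- The agents who submit a highest bid. -/
def highestBidders {pbar : ℕ} (m : Fin 2 → Bid pbar) : Finset (Fin 2) :=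
  Finset.univ.filter fun i => ∀ j, m j ≤ m i

/-- Probabilities of the allocations when the bids are `m`: the receiver of the object is uniformly
distributed on the highest bidders and pays the winner bid. -/
def winnerBidWeight {pbar : ℕ} (m : Fin 2 → Bid pbar) (a : Allocation pbar) : ℝ :=
  if a.1 ∈ highestBidders m ∧ a.2 = m a.1 then ((highestBidders m).card : ℝ)⁻¹ else 0

theorem highestBidders_nonempty {pbar : ℕ} (m : Fin 2 → Bid pbar) :
    (highestBidders m).Nonempty := by
  obtain ⟨i, -, hi⟩ := Finset.exists_max_image (Finset.univ : Finset (Fin 2)) m ⟨0, by simp⟩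
  exact ⟨i, by simpa [highestBidders] using hi⟩

theorem winnerBidWeight_mem {pbar : ℕ} (m : Fin 2 → Bid pbar) :
    winnerBidWeight m ∈ stdSimplex ℝ (Allocation pbar) := by
  have hc : ((highestBidders m).card : ℝ) ≠ 0 := by
    exact_mod_cast (Finset.card_pos.mpr (highestBidders_nonempty m)).ne'
  refine ⟨fun a => ?_, ?_⟩
  · unfold winnerBidWeight
    split_ifs <;> positivity
  · have h : ∀ i : Fin 2, ∑ b : Bid pbar, winnerBidWeight m (i, b) =
        if i ∈ highestBidders m then ((highestBidders m).card : ℝ)⁻¹ else 0 := by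
      intro i
      by_cases hi : i ∈ highestBidders m <;> simp [winnerBidWeight, hi]
    rw [Fintype.sum_prod_type, Finset.sum_congr rfl fun i _ => h i]
    simp [hc]

/-- The outcome function of the winner-bid auction, with values in the lotteries on allocations. -/
def winnerBidAuction (pbar : ℕ) : (Fin 2 → Bid pbar) → stdSimplex ℝ (Allocation pbar) :=
  fun m => ⟨winnerBidWeight m, winnerBidWeight_mem m⟩

/-! ### The complete information game of an outcome function `φ` and a profile of types `v` -/

section Game

variable {M : Type} [Fintype M] {pbar : ℕ}

/-- Profiles of mixed strategies: each agent's strategy is a probability distribution on `M`. -/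
def IsStrategyProfile (σ : Fin 2 → M → ℝ) : Prop := ∀ i, σ i ∈ stdSimplex ℝ M

/-- Expected utility of agent `i` from the action `m`, when the other agent, `i.rev`, selects an
action according to `σ i.rev`. -/
def expectedUtility (φ : (Fin 2 → M) → stdSimplex ℝ (Allocation pbar)) (v : Fin 2 → ℕ)
    (σ : Fin 2 → M → ℝ) (i : Fin 2) (m : M) : ℝ :=
  ∑ n : M, (∑ a, (φ (Function.update (fun _ => n) i m) : Allocation pbar → ℝ) a * utility v i a)
    * σ i.rev n

/-- Expected payoff of agent `i` at the profile `σ`. -/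
def payoff (φ : (Fin 2 → M) → stdSimplex ℝ (Allocation pbar)) (v : Fin 2 → ℕ)
    (σ : Fin 2 → M → ℝ) (i : Fin 2) : ℝ :=
  ∑ m : M, σ i m * expectedUtility φ v σ i m

/-- Nash equilibrium (in mixed strategies). -/
def IsNash (φ : (Fin 2 → M) → stdSimplex ℝ (Allocation pbar)) (v : Fin 2 → ℕ)
    (σ : Fin 2 → M → ℝ) : Prop :=
  IsStrategyProfile σ ∧ ∀ i m, 0 < σ i m → ∀ m',
    expectedUtility φ v σ i m' ≤ expectedUtility φ v σ i m

/-- Efficiency: the expected payoffs add up to the higher value. -/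
def IsEfficient (φ : (Fin 2 → M) → stdSimplex ℝ (Allocation pbar)) (v : Fin 2 → ℕ)
    (σ : Fin 2 → M → ℝ) : Prop :=
  payoff φ v σ 0 + payoff φ v σ 1 = ((max (v 0) (v 1) : ℕ) : ℝ)

/-- Weak payoff monotonicity: an action is played more often than another only if it is better. -/
def IsWeaklyPayoffMonotone (φ : (Fin 2 → M) → stdSimplex ℝ (Allocation pbar)) (v : Fin 2 → ℕ)
    (σ : Fin 2 → M → ℝ) : Prop :=
  IsStrategyProfile σ ∧ ∀ i m n, σ i n < σ i m →
    expectedUtility φ v σ i n < expectedUtility φ v σ i m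

/-- Empirical equilibrium: a Nash equilibrium that is the limit of a sequence of weakly payoff
monotone profiles. -/
def IsEmpiricalEquilibrium (φ : (Fin 2 → M) → stdSimplex ℝ (Allocation pbar)) (v : Fin 2 → ℕ)
    (σ : Fin 2 → M → ℝ) : Prop :=
  IsNash φ v σ ∧ ∃ s : ℕ → Fin 2 → M → ℝ,
    (∀ k, IsWeaklyPayoffMonotone φ v (s k)) ∧ Tendsto s atTop (𝓝 σ)

end Game

end PartnershipAuction

end

open PartnershipAuction

/-! Write the values as `2 * a < 2 * c`, with `r` the low agent's strategy and `q` the high agent's.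
Efficiency gives the object to the high agent with certainty, so every bid in the support of `q`
wins, and indifference leaves a single price `p`. The low agent bids below `p`. Optimality gives `a
≤ p ≤ c` and `1 ≤ (c - p + 1) * r (p - 1)`. The payoffs are `p` and `2 * c - p`, so the conditions
of the theorem are integer inequalities in `p`, `a`, `c`.

Upper bounds on `p`. Let `P = p - 1 = a + D`. Along a monotone approximation the low agent plays `P`
no more than any bid in `{P - n, ..., P}`, for `n ≤ min (4 * D) P` (`low_le`). This is proved
downwards: if the low agent's limit mass on the bids above `j` up to `P` is at least `r P`, the high
agent strictly prefers `j + 1` to `j`, so the high agent's trembles increase there; against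
increasing trembles the low agent does no better at `P` than one bid further down. These `n + 1`
bids each carry at least `r P ≥ 1 / (c - P)`, hence `n + P + 1 ≤ c` (`card_le`). In case of equality
the high agent's preference for `p` over `P` is decided by the low agent's trembles, which forces `P
< 2 * n` (`lt_two_mul`).

Conversely, let the low agent bid uniformly on `{L, ..., p - 1}`, a block of `4 * D + 1` bids in the
critical case. Trembles of size `ε` by the low agent make `p` the high agent's strict optimum;
trembles of sizes `η` and `η ^ 2` by the high agent, sorted by payoff, order the low agent's bids
lexicographically (`single_mem_closure_monotonePairs`). -/

namespace WinnerBid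

/-! ### Reduction of the auction to a game on natural numbers -/

/-- Utility of an agent with value `2 * w` who bids `b` against the bid `d`. -/
noncomputable def bidUtility (w : ℝ) (b d : ℕ) : ℝ :=
  if d < b then 2 * w - b else if b = d then w else d

/-- Expected utility of an agent with value `2 * w` who bids `b` when the other agent draws a bid
below `N` according to `q`. -/
noncomputable def bidPayoff (N : ℕ) (w : ℝ) (q : ℕ → ℝ) (b : ℕ) : ℝ :=
  ∑ n ∈ Finset.range N, bidUtility w b n * q n

theorem sum_winnerBidWeight_mul {pbar : ℕ} (m : Fin 2 → Bid pbar) (f : Allocation pbar → ℝ) :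
    ∑ x, winnerBidWeight m x * f x =
      ∑ j, if j ∈ highestBidders m then ((highestBidders m).card : ℝ)⁻¹ * f (j, m j) else 0 := by
  rw [Fintype.sum_prod_type]
  refine Finset.sum_congr rfl fun j _ => ?_
  by_cases hj : j ∈ highestBidders m <;> simp [winnerBidWeight, hj]

theorem sum_winnerBidWeight_mul_utility {pbar : ℕ} (v : Fin 2 → ℕ) (i : Fin 2) (m n : Bid pbar) :
    ∑ x, winnerBidWeight (Function.update (fun _ => n) i m) x * utility v i x =
      bidUtility ((v i : ℝ) / 2) m n := by
  rw [sum_winnerBidWeight_mul]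
  rcases lt_trichotomy m n with hmn | rfl | hmn
  · have hcard : highestBidders (Function.update (fun _ => n) i m) = {i.rev} := by
      ext j
      fin_cases i <;> fin_cases j <;>
        simp [highestBidders, Fin.forall_fin_two, hmn.le, hmn.not_ge, Function.update]
    rw [hcard]
    have h1 : ¬ (n : ℕ) < m := by simpa using hmn.le
    have h2 : (m : ℕ) ≠ n := by simpa [Fin.ext_iff] using hmn.ne
    fin_cases i <;> simp [utility, bidUtility, h1, h2, Function.update]
  · have hcard : highestBidders (Function.update (fun _ => m) i m) = Finset.univ := by
      ext j
      simp [highestBidders]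
    rw [hcard]
    fin_cases i <;> simp [utility, bidUtility, Fin.sum_univ_two] <;> ring
  · have hcard : highestBidders (Function.update (fun _ => n) i m) = {i} := by
      ext j
      fin_cases i <;> fin_cases j <;>
        simp [highestBidders, Fin.forall_fin_two, hmn.le, hmn.not_ge, Function.update]
    rw [hcard]
    have h1 : (n : ℕ) < m := by simpa using hmn
    fin_cases i <;> simp [utility, bidUtility, h1, Function.update] <;> ring

theorem expectedUtility_eq_bidPayoff {pbar : ℕ} (v : Fin 2 → ℕ) (σ : Fin 2 → Bid pbar → ℝ)
    (i : Fin 2) (m : Bid pbar) {q : ℕ → ℝ} (hq : ∀ n, σ i.rev n = q n) :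
    expectedUtility (winnerBidAuction pbar) v σ i m =
      bidPayoff (pbar + 1) ((v i : ℝ) / 2) q m := by
  unfold expectedUtility bidPayoff
  rw [← Fin.sum_univ_eq_sum_range (fun n => bidUtility ((v i : ℝ) / 2) m n * q n)]
  refine Finset.sum_congr rfl fun n _ => ?_
  rw [hq, ← sum_winnerBidWeight_mul_utility]
  rfl

/-! ### Properties of pairs of mixed strategies on `{0, ..., N - 1}` -/

/-- A probability distribution on `{0, ..., N - 1}`. -/
structure IsLottery (N : ℕ) (q : ℕ → ℝ) : Prop where
  nonneg : ∀ n < N, 0 ≤ q n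
  sum_eq : ∑ n ∈ Finset.range N, q n = 1

/-- Weak payoff monotonicity of `q` against `r` for an agent with value `2 * w`. -/
def IsMonotoneAgainst (N : ℕ) (w : ℝ) (q r : ℕ → ℝ) : Prop :=
  ∀ m < N, ∀ n < N, q n < q m → bidPayoff N w r n < bidPayoff N w r m

/-- `q` is a best response to `r` for an agent with value `2 * w`. -/
def IsBestResponse (N : ℕ) (w : ℝ) (q r : ℕ → ℝ) : Prop :=
  ∀ m < N, 0 < q m → ∀ n < N, bidPayoff N w r n ≤ bidPayoff N w r m

theorem rev_eq_of_ne {l h : Fin 2} (hlh : l ≠ h) : l.rev = h := by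
  revert l h
  decide

theorem forall_fin_two_of_ne {l h : Fin 2} (hlh : l ≠ h) (P : Fin 2 → Prop) :
    (∀ i, P i) ↔ P l ∧ P h := by
  refine ⟨fun H => ⟨H l, H h⟩, fun H i => ?_⟩
  have : i = l ∨ i = h := by omega
  rcases this with rfl | rfl
  exacts [H.1, H.2]

theorem mem_stdSimplex_iff_isLottery {pbar : ℕ} {x : Bid pbar → ℝ} {q : ℕ → ℝ}
    (hq : ∀ n, x n = q n) : x ∈ stdSimplex ℝ (Bid pbar) ↔ IsLottery (pbar + 1) q := by
  have hs : ∑ n, x n = ∑ n ∈ Finset.range (pbar + 1), q n := by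
    rw [← Fin.sum_univ_eq_sum_range]
    exact Finset.sum_congr rfl fun n _ => hq n
  constructor
  · rintro ⟨h1, h2⟩
    exact ⟨fun n hn => (hq ⟨n, hn⟩) ▸ h1 _, hs ▸ h2⟩
  · rintro ⟨h1, h2⟩
    exact ⟨fun n => hq n ▸ h1 _ n.2, hs ▸ h2⟩

section Bridge

variable {pbar : ℕ} {v : Fin 2 → ℕ} {σ : Fin 2 → Bid pbar → ℝ} {l h : Fin 2} {a c : ℕ}
  {q r : ℕ → ℝ}

theorem isWeaklyPayoffMonotone_iff (hlh : l ≠ h) (hl : v l = 2 * a) (hh : v h = 2 * c)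
    (hr : ∀ n, σ l n = r n) (hq : ∀ n, σ h n = q n) :
    IsWeaklyPayoffMonotone (winnerBidAuction pbar) v σ ↔
      (IsLottery (pbar + 1) r ∧ IsLottery (pbar + 1) q) ∧
        IsMonotoneAgainst (pbar + 1) a r q ∧ IsMonotoneAgainst (pbar + 1) c q r := by
  have h1 : l.rev = h := rev_eq_of_ne hlh
  have h2 : h.rev = l := rev_eq_of_ne hlh.symm
  unfold IsWeaklyPayoffMonotone IsStrategyProfile
  rw [forall_fin_two_of_ne hlh, forall_fin_two_of_ne hlh, mem_stdSimplex_iff_isLottery hr,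
    mem_stdSimplex_iff_isLottery hq]
  simp only [expectedUtility_eq_bidPayoff v σ l _ (h1 ▸ hq),
    expectedUtility_eq_bidPayoff v σ h _ (h2 ▸ hr), hr, hq, hl, hh, IsMonotoneAgainst,
    Fin.forall_iff]
  simp

theorem isNash_iff (hlh : l ≠ h) (hl : v l = 2 * a) (hh : v h = 2 * c)
    (hr : ∀ n, σ l n = r n) (hq : ∀ n, σ h n = q n) :
    IsNash (winnerBidAuction pbar) v σ ↔
      (IsLottery (pbar + 1) r ∧ IsLottery (pbar + 1) q) ∧
        IsBestResponse (pbar + 1) a r q ∧ IsBestResponse (pbar + 1) c q r := by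
  have h1 : l.rev = h := rev_eq_of_ne hlh
  have h2 : h.rev = l := rev_eq_of_ne hlh.symm
  unfold IsNash IsStrategyProfile
  rw [forall_fin_two_of_ne hlh, forall_fin_two_of_ne hlh, mem_stdSimplex_iff_isLottery hr,
    mem_stdSimplex_iff_isLottery hq]
  simp only [expectedUtility_eq_bidPayoff v σ l _ (h1 ▸ hq),
    expectedUtility_eq_bidPayoff v σ h _ (h2 ▸ hr), hr, hq, hl, hh, IsBestResponse,
    Fin.forall_iff]
  simp

theorem payoff_eq_sum_bidPayoff (hlh : l ≠ h) (hl : v l = 2 * a)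
    (hr : ∀ n, σ l n = r n) (hq : ∀ n, σ h n = q n) :
    payoff (winnerBidAuction pbar) v σ l =
      ∑ m ∈ Finset.range (pbar + 1), r m * bidPayoff (pbar + 1) a q m := by
  have h1 : l.rev = h := rev_eq_of_ne hlh
  unfold payoff
  rw [← Fin.sum_univ_eq_sum_range (fun m => r m * bidPayoff (pbar + 1) a q m)]
  refine Finset.sum_congr rfl fun m _ => ?_
  rw [hr, expectedUtility_eq_bidPayoff v σ l m (h1 ▸ hq), hl]
  simp

end Bridge

/-! ### Expected utilities -/

/-- Raising the bid by one costs 1 against lower bids, and `w - b - 1` is the gain both from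
breaking a tie at `b` and from reaching one at `b + 1`. All later payoff comparisons telescope this
increment. -/
theorem bidPayoff_succ_sub {N b : ℕ} (w : ℝ) (q : ℕ → ℝ) (hb : b + 1 < N) :
    bidPayoff N w q (b + 1) - bidPayoff N w q b =
      -∑ n ∈ Finset.range b, q n + (w - b - 1) * (q b + q (b + 1)) := by
  have key : ∀ n, bidUtility w (b + 1) n * q n - bidUtility w b n * q n =
      -(if n < b then q n else 0) + (if n = b then (w - b - 1) * q n else 0) +
        (if n = b + 1 then (w - b - 1) * q n else 0) := by
    intro n
    unfold bidUtility
    rcases lt_trichotomy n b with h | rfl | h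
    · simp [h, h.ne, h.trans (Nat.lt_succ_self b), (h.trans (Nat.lt_succ_self b)).ne]
      ring
    · simp
      ring
    · rcases Nat.lt_or_ge (b + 1) n with h' | h'
      · simp [h.not_gt, h.ne', h.ne, h'.not_gt, h'.ne', h'.ne]
      · obtain rfl : n = b + 1 := by omega
        simp
        ring
  unfold bidPayoff
  rw [← Finset.sum_sub_distrib, Finset.sum_congr rfl fun n _ => key n, Finset.sum_add_distrib,
    Finset.sum_add_distrib, Finset.sum_neg_distrib, ← Finset.sum_filter]
  have : (Finset.range N).filter (· < b) = Finset.range b := by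
    ext n
    simp
    omega
  rw [this]
  simp [hb, show b < N by omega]
  ring

theorem bidPayoff_single {N p : ℕ} (hp : p < N) (w : ℝ) (b : ℕ) :
    bidPayoff N w (Pi.single p 1) b = bidUtility w b p := by
  simp [bidPayoff, Pi.single_apply, hp]

theorem bidPayoff_of_support_lt {N p : ℕ} {r : ℕ → ℝ} (hr : IsLottery N r)
    (hsupp : ∀ n, p ≤ n → r n = 0) (w : ℝ) {b : ℕ} (hb : p ≤ b) :
    bidPayoff N w r b = 2 * w - b := by
  rw [← mul_one (2 * w - (b : ℝ)), ← hr.sum_eq, Finset.mul_sum]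
  refine Finset.sum_congr rfl fun n _ => ?_
  rcases Nat.lt_or_ge n p with h | h
  · rw [bidUtility, if_pos (by omega)]
  · simp [hsupp n h]

theorem tendsto_bidPayoff {ι : Type*} {f : Filter ι} {N : ℕ} {w : ℝ} {s : ι → ℕ → ℝ} {q : ℕ → ℝ}
    (hs : ∀ n, Tendsto (fun k => s k n) f (𝓝 (q n))) (b : ℕ) :
    Tendsto (fun k => bidPayoff N w (s k) b) f (𝓝 (bidPayoff N w q b)) :=
  tendsto_finsetSum _ fun n _ => (hs n).const_mul _

/-! ### Efficient equilibria -/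

theorem bidUtility_add_bidUtility (a c : ℝ) (m n : ℕ) :
    bidUtility c m n + bidUtility a n m =
      2 * c - (if n < m then 0 else if m = n then c - a else 2 * (c - a)) := by
  unfold bidUtility
  rcases lt_trichotomy n m with h | rfl | h
  · simp [h, h.not_gt, h.ne]
  · simp
    ring
  · simp [h, h.not_gt, h.ne]
    ring

/-- The joint payoff is `2 * c` minus an expected loss that is positive exactly when the low agent
may receive the object, ties included. Efficiency makes this sum of nonnegative terms vanish. -/
theorem eq_zero_of_payoffs_add_eq {N a c : ℕ} {q r : ℕ → ℝ} (hac : a < c)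
    (hq : IsLottery N q) (hr : IsLottery N r)
    (heff : ∑ n ∈ Finset.range N, r n * bidPayoff N a q n +
      ∑ m ∈ Finset.range N, q m * bidPayoff N c r m = 2 * c)
    {m n : ℕ} (hn : n < N) (hmn : m ≤ n) : q m * r n = 0 := by
  have hac' : (a : ℝ) < c := by exact_mod_cast hac
  set loss : ℕ → ℕ → ℝ := fun m n =>
    if n < m then 0 else if m = n then (c : ℝ) - a else 2 * (c - a) with hloss
  have hloss0 : ∀ m n, 0 ≤ loss m n := by
    intro m n
    simp only [hloss]
    split_ifs <;> linarith
  have h1 : ∑ n ∈ Finset.range N, r n * bidPayoff N a q n =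
      ∑ m ∈ Finset.range N, ∑ n ∈ Finset.range N, q m * r n * bidUtility a n m := by
    rw [Finset.sum_comm]
    refine Finset.sum_congr rfl fun n _ => ?_
    rw [bidPayoff, Finset.mul_sum]
    exact Finset.sum_congr rfl fun m _ => by ring
  have h2 : ∑ m ∈ Finset.range N, q m * bidPayoff N c r m =
      ∑ m ∈ Finset.range N, ∑ n ∈ Finset.range N, q m * r n * bidUtility c m n := by
    refine Finset.sum_congr rfl fun m _ => ?_
    rw [bidPayoff, Finset.mul_sum]
    exact Finset.sum_congr rfl fun n _ => by ring
  have h3 : ∑ m ∈ Finset.range N, ∑ n ∈ Finset.range N, q m * r n = 1 := by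
    rw [← Finset.sum_mul_sum, hq.sum_eq, hr.sum_eq, one_mul]
  have h4 : ∑ m ∈ Finset.range N, ∑ n ∈ Finset.range N, q m * r n * loss m n = 0 := by
    have : ∑ m ∈ Finset.range N, ∑ n ∈ Finset.range N, q m * r n * loss m n =
        (∑ m ∈ Finset.range N, ∑ n ∈ Finset.range N, q m * r n) * (2 * c) -
        (∑ m ∈ Finset.range N, ∑ n ∈ Finset.range N, q m * r n * bidUtility a n m +
          ∑ m ∈ Finset.range N, ∑ n ∈ Finset.range N, q m * r n * bidUtility c m n) := by
      simp only [Finset.sum_mul, ← Finset.sum_add_distrib, ← Finset.sum_sub_distrib]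
      refine Finset.sum_congr rfl fun m _ => Finset.sum_congr rfl fun n _ => ?_
      linear_combination (q m * r n) * (bidUtility_add_bidUtility (a : ℝ) c m n)
    rw [this, h3, ← h1, ← h2, heff]
    ring
  have hm : m < N := hmn.trans_lt hn
  have h5 : ∀ m ∈ Finset.range N, ∀ n ∈ Finset.range N, 0 ≤ q m * r n * loss m n :=
    fun m hm n hn => mul_nonneg (mul_nonneg (hq.nonneg m (Finset.mem_range.1 hm))
      (hr.nonneg n (Finset.mem_range.1 hn))) (hloss0 m n)
  have h6 := (Finset.sum_eq_zero_iff_of_nonneg fun m hm => Finset.sum_nonneg (h5 m hm)).1 h4 m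
    (Finset.mem_range.2 hm)
  have h7 := (Finset.sum_eq_zero_iff_of_nonneg (h5 m (Finset.mem_range.2 hm))).1 h6 n
    (Finset.mem_range.2 hn)
  have h8 : 0 < loss m n := by
    simp only [hloss, hmn.not_gt, if_false]
    split_ifs <;> linarith
  exact (mul_eq_zero.1 h7).resolve_right h8.ne'

theorem IsLottery.exists_pos {N : ℕ} {q : ℕ → ℝ} (hq : IsLottery N q) : ∃ m < N, 0 < q m := by
  by_contra! H
  have : ∑ n ∈ Finset.range N, q n ≤ 0 :=
    Finset.sum_nonpos fun n hn => H n (Finset.mem_range.1 hn)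
  linarith [hq.sum_eq]

/-- The structure of an equilibrium at which the object goes to the high value agent: this agent
bids the price `p`, the other agent bids less. -/
structure IsPriceEquilibrium (N a c p : ℕ) (q r : ℕ → ℝ) : Prop where
  lt : p < N
  pos : 0 < p
  le_price : a ≤ p
  price_le : p ≤ c
  high_eq : q = Pi.single p 1
  low_eq_zero : ∀ n, p ≤ n → r n = 0
  low_lottery : IsLottery N r
  one_le : 1 ≤ (c - p + 1) * r (p - 1)

theorem IsPriceEquilibrium.low_payoff {N a c p : ℕ} {q r : ℕ → ℝ}
    (h : IsPriceEquilibrium N a c p q r) (w : ℝ) :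
    ∑ n ∈ Finset.range N, r n * bidPayoff N w q n = p := by
  rw [← mul_one (p : ℝ), ← h.low_lottery.sum_eq, Finset.mul_sum]
  refine Finset.sum_congr rfl fun n _ => ?_
  rw [h.high_eq, bidPayoff_single h.lt]
  rcases Nat.lt_or_ge n p with hn | hn
  · rw [bidUtility, if_neg (by omega), if_neg (by omega), mul_comm]
  · simp [h.low_eq_zero n hn]

theorem IsPriceEquilibrium.high_payoff {N a c p : ℕ} {q r : ℕ → ℝ}
    (h : IsPriceEquilibrium N a c p q r) (w : ℝ) :
    ∑ m ∈ Finset.range N, q m * bidPayoff N w r m = 2 * w - p := by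
  rw [h.high_eq, Finset.sum_eq_single p]
  · rw [bidPayoff_of_support_lt h.low_lottery h.low_eq_zero w le_rfl]
    simp
  · intro m _ hm
    simp [hm]
  · intro hp
    exact absurd (Finset.mem_range.2 h.lt) hp

theorem exists_isPriceEquilibrium {N a c : ℕ} {q r : ℕ → ℝ} (hac : a < c)
    (hq : IsLottery N q) (hr : IsLottery N r) (hq0 : ∀ n, N ≤ n → q n = 0)
    (hr0 : ∀ n, N ≤ n → r n = 0) (hqr : IsBestResponse N c q r) (hrq : IsBestResponse N a r q)
    (heff : ∑ n ∈ Finset.range N, r n * bidPayoff N a q n +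
      ∑ m ∈ Finset.range N, q m * bidPayoff N c r m = 2 * c) :
    ∃ p, IsPriceEquilibrium N a c p q r := by
  obtain ⟨p, hp, hqp⟩ := hq.exists_pos
  have hzero := @eq_zero_of_payoffs_add_eq N a c q r hac hq hr heff
  have hsupp : ∀ m < N, 0 < q m → ∀ n, m ≤ n → r n = 0 := by
    intro m hm hqm n hmn
    rcases Nat.lt_or_ge n N with hn | hn
    · exact (mul_eq_zero.1 (hzero hn hmn)).resolve_left hqm.ne'
    · exact hr0 n hn
  have hpay : ∀ m < N, 0 < q m → bidPayoff N c r m = 2 * c - m := fun m hm hqm =>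
    bidPayoff_of_support_lt hr (hsupp m hm hqm) _ le_rfl
  have huniq : ∀ m, m ≠ p → q m = 0 := by
    intro m hmp
    rcases Nat.lt_or_ge m N with hm | hm
    · by_contra hne
      have hqm : 0 < q m := lt_of_le_of_ne (hq.nonneg m hm) (Ne.symm hne)
      have h1 := hqr m hm hqm p hp
      have h2 := hqr p hp hqp m hm
      rw [hpay m hm hqm, hpay p hp hqp] at h1 h2
      have : (m : ℝ) = p := by linarith
      exact hmp (by exact_mod_cast this)
    · exact hq0 m hm
  have hq1 : q p = 1 := by
    rw [← hq.sum_eq, Finset.sum_eq_single p (fun m _ hm => huniq m hm)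
      (fun h => absurd (Finset.mem_range.2 hp) h)]
  have hqs : q = Pi.single p 1 := by
    funext m
    by_cases hm : m = p
    · subst hm
      simp [hq1]
    · simp [hm, huniq m hm]
  have hp0 : 0 < p := by
    rcases Nat.eq_zero_or_pos p with rfl | h
    · obtain ⟨m, hm, hrm⟩ := hr.exists_pos
      exact absurd (hsupp 0 hp hqp m (Nat.zero_le _)) hrm.ne'
    · exact h
  have hap : a ≤ p := by
    -- A losing bid earns `p`, while matching `p` would earn `a`.
    obtain ⟨n, hn, hrn⟩ := hr.exists_pos
    have hnp : n < p := by
      by_contra h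
      exact hrn.ne' (hsupp p hp hqp n (by omega))
    have h1 := hrq n hn hrn p hp
    rw [hqs, bidPayoff_single hp, bidPayoff_single hp] at h1
    simp only [bidUtility, lt_irrefl, if_false, if_true, hnp.not_gt, hnp.ne] at h1
    exact_mod_cast h1
  obtain ⟨P, rfl⟩ : ∃ P, p = P + 1 := ⟨p - 1, by omega⟩
  have hstep := bidPayoff_succ_sub (c : ℝ) r hp
  have h0 := hsupp _ hp hqp
  have hsum : ∑ n ∈ Finset.range P, r n + r P = 1 := by
    rw [← Finset.sum_range_succ, ← hr.sum_eq]
    refine Finset.sum_subset (by simpa using hp.le) fun n _ hn => h0 n (by simpa using hn)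
  have hbest := hqr _ hp hqp P (by omega)
  rw [h0 (P + 1) le_rfl] at hstep
  -- The high agent does not gain by lowering the bid from `P + 1` to `P`; the mass below `P` is `1
  -- - r P`.
  have hone : (1 : ℝ) ≤ (c - (P + 1 : ℕ) + 1) * r P := by
    push_cast
    linarith
  have hrP : 0 ≤ r P := hr.nonneg P (by omega)
  have hpc : P + 1 ≤ c := by
    by_contra h
    have : (c : ℝ) + 1 ≤ (P + 1 : ℕ) := by exact_mod_cast not_le.1 h
    nlinarith
  exact ⟨P + 1, hp, hp0, hap, hpc, hqs, h0, hr, by simpa using hone⟩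

/-! ### Limits of monotone pairs -/

/-- Telescoping increments from `b` to `P`, the accumulated coefficient of `q (b + 1)` stays
nonpositive while `n ≤ 4 * D`, so monotonicity allows `q b` in its place. The bound is nonpositive
in this range, which is the origin of the number `4 * D`. -/
theorem bidPayoff_sub_le_of_monotone {N a P D : ℕ} {q : ℕ → ℝ} (hP : P < N) (hD : P = a + D)
    (n : ℕ) : ∀ b, b + n = P → n ≤ 4 * D → (∀ j, 0 ≤ q j) →
      (∀ j, b ≤ j → j < P → q j ≤ q (j + 1)) →
      bidPayoff N a q P - bidPayoff N a q b ≤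
        n * (((n : ℝ) - 1) / 2 - 2 * D) * q b - n * ∑ i ∈ Finset.range b, q i := by
  induction n with
  | zero =>
    rintro b rfl _ _ _
    simp
  | succ n ih =>
    intro b hb hn hq0 hmono
    have h1 := ih (b + 1) (by omega) (by omega) hq0 fun j hj => hmono j (by omega)
    have h2 := bidPayoff_succ_sub (a : ℝ) q (show b + 1 < N by omega)
    have h3 := hmono b le_rfl (by omega)
    rw [Finset.sum_range_succ] at h1
    have hb' : (b : ℝ) = a + D - n - 1 := by
      have : ((b + (n + 1) : ℕ) : ℝ) = ((a + D : ℕ) : ℝ) := by rw [hb, hD]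
      push_cast at this
      linarith
    rw [hb'] at h2
    have hn' : (n : ℝ) + 1 ≤ 4 * D := by exact_mod_cast hn
    have hn0 : (0 : ℝ) ≤ n := Nat.cast_nonneg n
    have h4 : (n * (((n : ℝ) - 1) / 2 - 2 * D) + (n - D)) * q (b + 1) ≤
        (n * (((n : ℝ) - 1) / 2 - 2 * D) + (n - D)) * q b := by
      refine mul_le_mul_of_nonpos_left h3 ?_
      nlinarith
    push_cast
    linarith

/-- A sequence of pairs of mutually monotone strategies that converges to an equilibrium at which
the object is sold at the price `p`. -/
structure IsMonotoneApproximation (N a c p : ℕ) (s t : ℕ → ℕ → ℝ) (r : ℕ → ℝ) : Prop where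
  eq : IsPriceEquilibrium N a c p (Pi.single p 1) r
  high_nonneg : ∀ k n, 0 ≤ s k n
  low_nonneg : ∀ k n, 0 ≤ t k n
  high_mono : ∀ k, IsMonotoneAgainst N c (s k) (t k)
  low_mono : ∀ k, IsMonotoneAgainst N a (t k) (s k)
  high_tendsto : ∀ n, Tendsto (fun k => s k n) atTop (𝓝 ((Pi.single p 1 : ℕ → ℝ) n))
  low_tendsto : ∀ n, Tendsto (fun k => t k n) atTop (𝓝 (r n))

/-! ### Upper bounds on the price -/

section Necessity

variable {N a c P : ℕ} {s t : ℕ → ℕ → ℝ} {r : ℕ → ℝ}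

theorem IsPriceEquilibrium.low_pos {q : ℕ → ℝ} (h : IsPriceEquilibrium N a c (P + 1) q r) :
    0 < r P := by
  have h1 := h.one_le
  have h2 : (1 : ℝ) + P ≤ c := by exact_mod_cast (by simpa [add_comm] using h.price_le)
  simp only [Nat.add_sub_cancel] at h1
  push_cast at h1
  by_contra hneg
  nlinarith

theorem IsPriceEquilibrium.sum_range_succ_eq_one {q : ℕ → ℝ}
    (h : IsPriceEquilibrium N a c (P + 1) q r) : ∑ n ∈ Finset.range (P + 1), r n = 1 := by
  rw [← h.low_lottery.sum_eq]
  exact Finset.sum_subset (by simpa using h.lt.le) fun n _ hn => h.low_eq_zero n (by simpa using hn)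

theorem mul_le_sum_of_le {f : ℕ → ℝ} {x : ℝ} {b n : ℕ} (hf : ∀ i, b ≤ i → i < b + n → x ≤ f i)
    : ∑ i ∈ Finset.range b, f i + n * x ≤ ∑ i ∈ Finset.range (b + n), f i := by
  rw [Finset.sum_range_add]
  have := Finset.card_nsmul_le_sum (Finset.range n) (fun i => f (b + i)) x fun i hi =>
    hf _ (by omega) (by have := Finset.mem_range.1 hi; omega)
  simpa using this

/-- With `1 ≤ (c - P) * r P` and mass at least `r P` on each bid in `{j + 1, ..., P}`, the limit
increment at `j` is at least `(2 * (P - j) - 1) * r P > 0`. Monotonicity turns this strict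
preference into an order of the trembles. -/
theorem IsMonotoneApproximation.high_le_succ (h : IsMonotoneApproximation N a c (P + 1) s t r)
    {j : ℕ} (hj : j < P) (hr : ∀ b, j < b → b ≤ P → r P ≤ r b) :
    ∀ᶠ k in atTop, s k j ≤ s k (j + 1) := by
  have hN := h.eq.lt
  have hpos := h.eq.low_pos
  have hsum := h.eq.sum_range_succ_eq_one
  have hone := h.eq.one_le
  have hc : (P : ℝ) + 1 ≤ c := by exact_mod_cast h.eq.price_le
  have hj' : (j : ℝ) + 1 ≤ P := by exact_mod_cast hj
  have hlim : 0 < bidPayoff N c r (j + 1) - bidPayoff N c r j := by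
    rw [bidPayoff_succ_sub _ _ (by omega)]
    have h1 := mul_le_sum_of_le (f := r) (x := r P) (b := j + 1) (n := P - j)
      fun i hi hi' => hr i (by omega) (by omega)
    rw [show j + 1 + (P - j) = P + 1 by omega, hsum, Finset.sum_range_succ,
      Nat.cast_sub hj.le] at h1
    have h2 := hr (j + 1) (by omega) (by omega)
    have h3 := h.eq.low_lottery.nonneg j (by omega)
    simp only [Nat.add_sub_cancel] at hone
    push_cast at hone
    have h4 : (c - j - 1) * r P ≤ ((c : ℝ) - j - 1) * r (j + 1) :=
      mul_le_mul_of_nonneg_left h2 (by linarith)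
    have h5 : 0 ≤ ((c : ℝ) - j - 1) * r j := mul_nonneg (by linarith) h3
    nlinarith
  have hten := (tendsto_bidPayoff (N := N) (w := c) h.low_tendsto (j + 1)).sub
    (tendsto_bidPayoff (N := N) (w := c) h.low_tendsto j)
  filter_upwards [hten.eventually (lt_mem_nhds hlim)] with k hk
  by_contra hlt
  have := h.high_mono k j (by omega) (j + 1) (by omega) (not_le.1 hlt)
  linarith

theorem IsMonotoneApproximation.low_le (h : IsMonotoneApproximation N a c (P + 1) s t r)
    {D : ℕ} (hD : P = a + D) (n : ℕ) : n ≤ 4 * D → n ≤ P →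
      ∀ᶠ k in atTop, ∀ b, P - n ≤ b → b ≤ P → t k P ≤ t k b := by
  have hN := h.eq.lt
  induction n with
  | zero =>
    refine fun _ _ => Eventually.of_forall fun k b h1 h2 => ?_
    rw [show b = P by omega]
  | succ n ih =>
    intro hn hnP
    have ih' := ih (by omega) (by omega)
    have hr : ∀ b, P - n ≤ b → b ≤ P → r P ≤ r b := fun b h1 h2 =>
      le_of_tendsto_of_tendsto (h.low_tendsto P) (h.low_tendsto b)
        (ih'.mono fun k hk => hk b h1 h2)
    have hmono : ∀ᶠ k in atTop, ∀ j ∈ Finset.Ico (P - (n + 1)) P, s k j ≤ s k (j + 1) := by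
      rw [Finset.eventually_all]
      intro j hj
      rw [Finset.mem_Ico] at hj
      exact h.high_le_succ hj.2 fun b h1 h2 => hr b (by omega) h2
    filter_upwards [ih', hmono] with k hk1 hk2 b hb1 hb2
    rcases Nat.lt_or_ge b (P - n) with hb | hb
    · obtain rfl : b = P - (n + 1) := by omega
      by_contra hlt
      have h1 := h.low_mono k P (by omega) (P - (n + 1)) (by omega) (not_le.1 hlt)
      have h2 := bidPayoff_sub_le_of_monotone (show P < N by omega) hD (n + 1) (P - (n + 1))
        (by omega) hn (h.high_nonneg k) fun j hj hj' => hk2 j (Finset.mem_Ico.2 ⟨hj, hj'⟩)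
      have h3 : 0 ≤ ∑ i ∈ Finset.range (P - (n + 1)), s k i :=
        Finset.sum_nonneg fun i _ => h.high_nonneg k i
      have h4 := h.high_nonneg k (P - (n + 1))
      have hn' : (n : ℝ) + 1 ≤ 4 * D := by exact_mod_cast hn
      have hn0 : (0 : ℝ) ≤ n := Nat.cast_nonneg n
      push_cast at h2
      have h5 : ((n : ℝ) + 1) * ((n + 1 - 1) / 2 - 2 * D) * s k (P - (n + 1)) ≤ 0 :=
        mul_nonpos_of_nonpos_of_nonneg
          (mul_nonpos_of_nonneg_of_nonpos (by linarith) (by linarith)) h4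
      have h6 : 0 ≤ ((n : ℝ) + 1) * ∑ i ∈ Finset.range (P - (n + 1)), s k i :=
        mul_nonneg (by linarith) h3
      linarith
    · exact hk1 b hb hb2

/-- When `P = a`, the factor `a - b - 1` vanishes at `b = P - 1`, so raising the bid to `P` never
helps, whatever the opponent does. -/
theorem IsMonotoneApproximation.low_le_pred (h : IsMonotoneApproximation N a c (P + 1) s t r)
    (ha : P = a) : ∀ᶠ k in atTop, ∀ b, P - 1 ≤ b → b ≤ P → t k P ≤ t k b := by
  have hN := h.eq.lt
  refine Eventually.of_forall fun k b hb1 hb2 => ?_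
  rcases Nat.lt_or_ge b P with hb | hb
  · obtain ⟨x, rfl⟩ : ∃ x, P = x + 1 := ⟨P - 1, by omega⟩
    obtain rfl : b = x := by omega
    by_contra hlt
    have h1 := h.low_mono k (b + 1) (by omega) b (by omega) (not_le.1 hlt)
    have h2 := bidPayoff_succ_sub (a : ℝ) (s k) (show b + 1 < N by omega)
    have h3 : 0 ≤ ∑ i ∈ Finset.range b, s k i :=
        Finset.sum_nonneg fun i _ => h.high_nonneg k i
    have h4 : (a : ℝ) - b - 1 = 0 := by
      rw [← ha]
      push_cast
      ring
    rw [h4] at h2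
    linarith
  · rw [show b = P by omega]

theorem IsMonotoneApproximation.card_le (h : IsMonotoneApproximation N a c (P + 1) s t r)
    {n : ℕ} (hn : n ≤ P) (hle : ∀ᶠ k in atTop, ∀ b, P - n ≤ b → b ≤ P → t k P ≤ t k b) :
    n + P + 1 ≤ c := by
  have hr : ∀ b, P - n ≤ b → b ≤ P → r P ≤ r b := fun b h1 h2 =>
    le_of_tendsto_of_tendsto (h.low_tendsto P) (h.low_tendsto b) (hle.mono fun k hk => hk b h1 h2)
  have h1 := mul_le_sum_of_le (f := r) (x := r P) (b := P - n) (n := n + 1)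
    fun i hi hi' => hr i (by omega) (by omega)
  rw [show P - n + (n + 1) = P + 1 by omega, h.eq.sum_range_succ_eq_one] at h1
  have h2 : 0 ≤ ∑ i ∈ Finset.range (P - n), r i := Finset.sum_nonneg fun i hi =>
    h.eq.low_lottery.nonneg i (by have := Finset.mem_range.1 hi; have := h.eq.lt; omega)
  have h3 := h.eq.one_le
  have hpos := h.eq.low_pos
  simp only [Nat.add_sub_cancel] at h3
  push_cast at h1 h3
  -- The `n + 1` bids have total mass at most 1, and `(c - P) * r P ≥ 1`.
  have h4 : ((n : ℝ) + 1) ≤ c - (P + 1) + 1 := by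
    by_contra hlt
    nlinarith
  have h5 : ((n + P + 1 : ℕ) : ℝ) ≤ c := by
    push_cast
    linarith
  exact_mod_cast h5

/-- Here `c - P - 1 = n`, so in the high agent's increment from `P` to `P + 1` the gain `n * t k P`
is cancelled by the `n` bids just below `P`. What remains compares `n` with `P - n` as multiples of
`t k (P + 1)`. -/
theorem IsMonotoneApproximation.lt_two_mul (h : IsMonotoneApproximation N a c (P + 1) s t r)
    (ha : a ≤ P) {n : ℕ} (hn : n ≤ P) (hc : n + P + 1 = c)
    (hle : ∀ᶠ k in atTop, ∀ b, P - n ≤ b → b ≤ P → t k P ≤ t k b) : P < 2 * n := by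
  have hN := h.eq.lt
  have ha' : (a : ℝ) < P + 1 := by exact_mod_cast Nat.lt_succ_of_le ha
  have h1 : ∀ᶠ k in atTop, s k P < s k (P + 1) :=
    (h.high_tendsto P).eventually_lt (h.high_tendsto (P + 1)) (by simp)
  -- In the limit a losing bid earns `P + 1 > a`, so the price is a worse bid for the low agent than
  -- every lower bid.
  have h2 : ∀ᶠ k in atTop, ∀ b ∈ Finset.range (P + 1),
      bidPayoff N a (s k) (P + 1) < bidPayoff N a (s k) b := by
    rw [Finset.eventually_all]
    intro b hb
    have hb' := Finset.mem_range.1 hb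
    refine (tendsto_bidPayoff h.high_tendsto _).eventually_lt
      (tendsto_bidPayoff h.high_tendsto _) ?_
    rw [bidPayoff_single hN, bidPayoff_single hN]
    simpa [bidUtility, hb'.not_gt, hb'.ne] using ha'
  obtain ⟨k, hk1, hk2, hk3⟩ := (h1.and (h2.and hle)).exists
  have h3 := h.high_mono k (P + 1) hN P (by omega) hk1
  have h4 : ∀ b, b < P + 1 → t k (P + 1) ≤ t k b := by
    intro b hb
    by_contra hlt
    have := h.low_mono k (P + 1) hN b (by omega) (not_le.1 hlt)
    linarith [hk2 b (Finset.mem_range.2 hb)]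
  have h5 := bidPayoff_succ_sub (c : ℝ) (t k) hN
  have h6 := mul_le_sum_of_le (f := t k) (x := t k (P + 1)) (b := 0) (n := P - n)
    fun i _ hi => h4 i (by omega)
  have h7 := mul_le_sum_of_le (f := t k) (x := t k P) (b := P - n) (n := n)
    fun i hi hi' => hk3 i hi (by omega)
  rw [Nat.sub_add_cancel hn] at h7
  simp only [zero_add, Finset.range_zero, Finset.sum_empty] at h6
  rw [Nat.cast_sub hn] at h6
  have h8 : (c : ℝ) = n + P + 1 := by exact_mod_cast hc.symm
  have h9 := h.low_nonneg k (P + 1)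
  by_contra hge
  have h10 : (2 : ℝ) * n ≤ P := by exact_mod_cast not_lt.1 hge
  rw [h8] at h5 h3
  nlinarith

/-- The bounds on the price at a limit of monotone pairs of strategies. -/
theorem IsMonotoneApproximation.price_bounds {p : ℕ} (h : IsMonotoneApproximation N a c p s t r)
    (ha : 2 ≤ a) (hac : a < c) :
    (c ≤ a + 2 → p = a) ∧ (a + 2 < c → 8 * a ≤ 3 * c → 2 * p ≤ c + 1) ∧
      (a + 2 < c → 3 * c < 8 * a → 5 * p ≤ c + 4 * a + 4) ∧
      (a + 2 < c → 3 * c < 8 * a → 7 * (c - 1) ≤ 12 * a → 5 * p < c + 4 * a + 4) := by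
  rcases h.eq.le_price.eq_or_lt with rfl | hap
  · exact ⟨fun _ => rfl, by omega, by omega, by omega⟩
  obtain ⟨P, rfl⟩ : ∃ P, p = P + 1 := ⟨p - 1, by omega⟩
  obtain ⟨D, hD⟩ := Nat.exists_eq_add_of_le (show a ≤ P by omega)
  have hpc := h.eq.price_le
  rcases Nat.eq_zero_or_pos D with rfl | hD0
  · have hle := h.low_le_pred hD
    -- This gives `a + 2 ≤ c`; equality would require `a < 2`.
    have h1 := h.card_le (show 1 ≤ P by omega) hle
    have h2 := fun hc => h.lt_two_mul (show a ≤ P by omega) (show 1 ≤ P by omega) hc hle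
    refine ⟨fun _ => ?_, by omega, by omega, by omega⟩
    have := h2 (by omega)
    omega
  · rcases Nat.le_total (4 * D) P with hDP | hDP
    · have hle := h.low_le hD (4 * D) le_rfl hDP
      -- This is `5 * p ≤ c + 4 * a + 4`; equality needs `P < 8 * D`, which `7 * (c - 1) ≤ 12 * a`
      -- excludes.
      have h1 := h.card_le hDP hle
      have h2 := fun hc => h.lt_two_mul (show a ≤ P by omega) hDP hc hle
      refine ⟨by omega, by omega, by omega, fun _ _ _ => ?_⟩
      by_contra hlt
      have := h2 (by omega)
      omega
    · have hle := h.low_le hD P hDP le_rfl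
      -- All bids up to `P` are covered, which gives `2 * p ≤ c + 1`.
      have h1 := h.card_le le_rfl hle
      exact ⟨by omega, by omega, by omega, by omega⟩

end Necessity

/-! ### Construction of monotone pairs -/

theorem eventually_lexicographic_pos (α β : ℝ) {x y z : ℝ}
    (h : 0 < x ∨ x = 0 ∧ (0 < y ∨ y = 0 ∧ 0 < z)) :
    ∀ᶠ η : ℝ in 𝓝[>] 0, 0 < (1 - α * η - β * η ^ 2) * x + η * y + η ^ 2 * z := by
  rcases h with hx | ⟨rfl, hy | ⟨rfl, hz⟩⟩
  · have hc : ContinuousAt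
        (fun η : ℝ => (1 - α * η - β * η ^ 2) * x + η * y + η ^ 2 * z) 0 := by fun_prop
    exact nhdsWithin_le_nhds (hc.eventually (lt_mem_nhds (by simpa using hx)))
  · have hc : ContinuousAt (fun η : ℝ => y + η * z) 0 := by fun_prop
    filter_upwards [nhdsWithin_le_nhds (hc.eventually (lt_mem_nhds (a := 0) (by simpa using hy))),
      self_mem_nhdsWithin] with η h1 h2
    have := mul_pos h2 h1
    linarith
  · filter_upwards [self_mem_nhdsWithin] with η h2
    have := mul_pos (pow_pos (Set.mem_Ioi.1 h2) 2) hz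
    linarith

/-- The pairs of strategies that are monotone against each other. -/
def monotonePairs (N a c : ℕ) : Set ((ℕ → ℝ) × (ℕ → ℝ)) :=
  {x | (IsLottery N x.2 ∧ IsLottery N x.1) ∧
    IsMonotoneAgainst N a x.2 x.1 ∧ IsMonotoneAgainst N c x.1 x.2}

/-- The strategy that bids `p` except for small deviations, of probability `η` on `H` and `η ^ 2`
on `R`. -/
noncomputable def perturbedBid (H R : Finset ℕ) (p : ℕ) (η : ℝ) : ℕ → ℝ := fun n =>
  (1 - H.card * η - R.card * η ^ 2) * (Pi.single p 1 : ℕ → ℝ) n + η * (if n ∈ H then 1 else 0) +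
    η ^ 2 * (if n ∈ R then 1 else 0)

/-- Payoffs against the uniform weight on `H`. -/
noncomputable def payoffOn (w : ℝ) (H : Finset ℕ) (b : ℕ) : ℝ := ∑ n ∈ H, bidUtility w b n

theorem bidPayoff_indicator {N : ℕ} {H : Finset ℕ} (hH : H ⊆ Finset.range N) (w : ℝ) (b : ℕ) :
    bidPayoff N w (fun n => if n ∈ H then 1 else 0) b = payoffOn w H b := by
  simp only [bidPayoff, payoffOn, mul_ite, mul_one, mul_zero]
  rw [← Finset.sum_filter]
  congr 1
  ext n
  simpa using fun h => Finset.mem_range.1 (hH h)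

theorem bidPayoff_perturbedBid {N p : ℕ} {H R : Finset ℕ} (hp : p < N)
    (hH : H ⊆ Finset.range N) (hR : R ⊆ Finset.range N) (w η : ℝ) (b : ℕ) :
    bidPayoff N w (perturbedBid H R p η) b =
      (1 - H.card * η - R.card * η ^ 2) * bidUtility w b p + η * payoffOn w H b +
        η ^ 2 * payoffOn w R b := by
  rw [← bidPayoff_single hp, ← bidPayoff_indicator hH, ← bidPayoff_indicator hR]
  simp only [bidPayoff, Finset.mul_sum, ← Finset.sum_add_distrib]
  exact Finset.sum_congr rfl fun n _ => by
    rw [perturbedBid]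
    ring

/-- The low strategy stays fixed and only the high agent trembles. Bids of equal probability need no
payoff comparison, so it suffices that `p` beats `H` and `H` beats `R`. For small `η` the low
agent's payoffs are ordered lexicographically: against `p`, then `H`, then `R`. -/
theorem single_mem_closure_monotonePairs {N a c p : ℕ} {r : ℕ → ℝ} {H R : Finset ℕ}
    (hr : IsLottery N r) (hp : p < N)
    (hbest : ∀ b < N, b ≠ p → bidPayoff N c r b < bidPayoff N c r p)
    (hH : H ⊆ Finset.range N) (hR : R ⊆ Finset.range N) (hpH : p ∉ H) (hpR : p ∉ R)
    (hdisj : Disjoint H R) (hcover : ∀ b < N, b ≠ p → b ∈ H ∨ b ∈ R)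
    (hHR : ∀ m ∈ H, ∀ n ∈ R, bidPayoff N c r n < bidPayoff N c r m)
    (hlex : ∀ m < N, ∀ n < N, r n < r m →
      0 < bidUtility a m p - bidUtility a n p ∨ bidUtility a m p - bidUtility a n p = 0 ∧
        (0 < payoffOn a H m - payoffOn a H n ∨ payoffOn a H m - payoffOn a H n = 0 ∧
          0 < payoffOn a R m - payoffOn a R n)) :
    (Pi.single p 1, r) ∈ closure (monotonePairs N a c) := by
  have hten : Tendsto (fun η : ℝ => (perturbedBid H R p η, r)) (𝓝[>] 0) (𝓝 (Pi.single p 1, r)) := by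
    have hcont : Continuous (fun η : ℝ => (perturbedBid H R p η, r)) := by
      refine Continuous.prodMk (continuous_pi fun n => ?_) continuous_const
      unfold perturbedBid
      fun_prop
    have h0 : perturbedBid H R p 0 = Pi.single p 1 := by
      funext n
      simp [perturbedBid]
    have := hcont.tendsto 0
    rw [h0] at this
    exact this.mono_left nhdsWithin_le_nhds
  refine mem_closure_of_tendsto hten ?_
  have hlow : ∀ᶠ η : ℝ in 𝓝[>] 0, ∀ m ∈ Finset.range N, ∀ n ∈ Finset.range N, r n < r m →
      bidPayoff N a (perturbedBid H R p η) n < bidPayoff N a (perturbedBid H R p η) m := by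
    simp only [Finset.eventually_all, eventually_imp_distrib_left]
    intro m hm n hn hmn
    filter_upwards [eventually_lexicographic_pos H.card R.card
      (hlex m (Finset.mem_range.1 hm) n (Finset.mem_range.1 hn) hmn)] with η hη
    rw [bidPayoff_perturbedBid hp hH hR, bidPayoff_perturbedBid hp hH hR]
    linarith
  have hlarge : ∀ᶠ η : ℝ in 𝓝[>] 0, η < 1 - H.card * η - R.card * η ^ 2 := by
    have hc : ContinuousAt (fun η : ℝ => 1 - H.card * η - R.card * η ^ 2 - η) 0 := by fun_prop
    filter_upwards [nhdsWithin_le_nhds (hc.eventually (lt_mem_nhds (a := 0) (by simp)))] with η hη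
    linarith
  have hone : ∀ᶠ η : ℝ in 𝓝[>] 0, η < 1 := nhdsWithin_le_nhds (gt_mem_nhds one_pos)
  filter_upwards [hlow, hlarge, hone, self_mem_nhdsWithin] with η h1 h2 h3 h4
  rw [Set.mem_Ioi] at h4
  have h5 : η ^ 2 < η := by nlinarith
  have h6 : 0 < η ^ 2 := by positivity
  have hvp : perturbedBid H R p η p = 1 - H.card * η - R.card * η ^ 2 := by
    simp [perturbedBid, hpH, hpR]
  have hvH : ∀ n ∈ H, perturbedBid H R p η n = η := fun n hn => by
    have h7 : n ≠ p := fun h => hpH (h ▸ hn)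
    simp [perturbedBid, hn, h7, Finset.disjoint_left.1 hdisj hn]
  have hvR : ∀ n ∈ R, perturbedBid H R p η n = η ^ 2 := fun n hn => by
    have h7 : n ≠ p := fun h => hpR (h ▸ hn)
    simp [perturbedBid, hn, h7, Finset.disjoint_right.1 hdisj hn]
  have hcases : ∀ n < N, n = p ∨ n ∈ H ∨ n ∈ R := fun n hn => by
    by_cases h : n = p
    exacts [Or.inl h, Or.inr (hcover n hn h)]
  refine ⟨⟨hr, fun n hn => ?_, ?_⟩, fun m hm n hn hmn => h1 m (Finset.mem_range.2 hm) n
    (Finset.mem_range.2 hn) hmn, fun m hm n hn hmn => ?_⟩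
  · rcases hcases n hn with rfl | h | h
    · dsimp only
      linarith
    · exact h4.le.trans_eq (hvH n h).symm
    · exact h6.le.trans_eq (hvR n h).symm
  · simp only [perturbedBid, Finset.sum_add_distrib, ← Finset.mul_sum]
    have e1 : ∑ n ∈ Finset.range N, (if n ∈ H then (1 : ℝ) else 0) = H.card := by
      rw [Finset.sum_ite_mem, Finset.inter_eq_right.2 hH]
      simp
    have e2 : ∑ n ∈ Finset.range N, (if n ∈ R then (1 : ℝ) else 0) = R.card := by
      rw [Finset.sum_ite_mem, Finset.inter_eq_right.2 hR]
      simp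
    have e3 : ∑ n ∈ Finset.range N, (Pi.single p 1 : ℕ → ℝ) n = 1 := by
      simp [Pi.single_apply, hp]
    rw [e1, e2, e3]
    ring
  · dsimp only at hmn ⊢
    rcases hcases m hm with rfl | h | h <;> rcases hcases n hn with rfl | h' | h'
    · exact absurd hmn (lt_irrefl _)
    · exact hbest n hn fun e => hpH (e ▸ h')
    · exact hbest n hn fun e => hpR (e ▸ h')
    · rw [hvp, hvH m h] at hmn
      linarith
    · rw [hvH m h, hvH n h'] at hmn
      linarith
    · exact hHR m h n h'
    · rw [hvp, hvR m h] at hmn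
      linarith
    · rw [hvR m h, hvH n h'] at hmn
      linarith
    · rw [hvR m h, hvR n h'] at hmn
      linarith

/-- The strategy that bids uniformly on `{L, ..., p - 1}` except for small deviations, of
probability `ε` on `{0, ..., L - 1} ∪ {p}`. -/
noncomputable def blockBid (L p : ℕ) (ε : ℝ) : ℕ → ℝ := fun n =>
  if n < L ∨ n = p then ε else if n < p then (1 - (L + 1) * ε) / ((p : ℝ) - L) else 0

theorem sum_range_blockBid {L p : ℕ} (ε : ℝ) {j : ℕ} (hLj : L ≤ j) (hjp : j ≤ p) :
    ∑ n ∈ Finset.range j, blockBid L p ε n =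
      L * ε + ((j : ℝ) - L) * ((1 - (L + 1) * ε) / ((p : ℝ) - L)) := by
  induction j, hLj using Nat.le_induction with
  | base =>
    have : ∀ n ∈ Finset.range L, blockBid L p ε n = ε := fun n hn =>
      if_pos (Or.inl (Finset.mem_range.1 hn))
    rw [Finset.sum_congr rfl this]
    simp
  | succ j hj ih =>
    rw [Finset.sum_range_succ, ih (by omega), blockBid, if_neg (by omega), if_pos (by omega)]
    push_cast
    ring

theorem isLottery_blockBid {N L p : ℕ} {ε : ℝ} (hL : L < p) (hp : p < N) (hε : 0 ≤ ε)
    (hε' : (L + 1) * ε ≤ 1) : IsLottery N (blockBid L p ε) := by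
  have hL' : (L : ℝ) < p := by exact_mod_cast hL
  refine ⟨fun n _ => ?_, ?_⟩
  · unfold blockBid
    split_ifs
    exacts [hε, div_nonneg (by linarith) (by linarith), le_rfl]
  · have : ∑ n ∈ Finset.range (p + 1), blockBid L p ε n =
        ∑ n ∈ Finset.range N, blockBid L p ε n := by
      refine Finset.sum_subset (by simpa using hp) fun n _ hn => ?_
      have := Finset.mem_range.not.1 hn
      rw [blockBid, if_neg (by omega), if_neg (by omega)]
    rw [← this, Finset.sum_range_succ, sum_range_blockBid ε hL.le le_rfl, blockBid,
      if_pos (Or.inr rfl)]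
    field_simp [sub_ne_zero.2 hL'.ne']
    ring

theorem blockBid_zero_apply {L p n : ℕ} :
    blockBid L p 0 n = if L ≤ n ∧ n < p then ((p : ℝ) - L)⁻¹ else 0 := by
  unfold blockBid
  by_cases h1 : n < L <;> by_cases h2 : n = p <;> by_cases h3 : n < p <;>
    simp [h1, h2, h3, not_lt.1, not_le.2]

/-! ### The high agent's payoffs against a block of bids -/

section HighPayoff

variable {N c L p : ℕ}

theorem blockBid_zero_step (hL : L < p) (hpc : p ≤ c) (hpN : p < N) (hLc : 2 * p ≤ c + 1 + L)
    {j : ℕ} (hj : j < p) :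
    bidPayoff N c (blockBid L p 0) j ≤ bidPayoff N c (blockBid L p 0) (j + 1) ∧
      (L ≤ j + 1 → j + 1 < p → bidPayoff N c (blockBid L p 0) j <
        bidPayoff N c (blockBid L p 0) (j + 1)) := by
  have hstep := bidPayoff_succ_sub (c : ℝ) (blockBid L p 0) (show j + 1 < N by omega)
  have hL' : (L : ℝ) < p := by exact_mod_cast hL
  have hμ : 0 < ((p : ℝ) - L)⁻¹ := inv_pos.2 (by linarith)
  have hjc : (j : ℝ) + 1 ≤ c := by exact_mod_cast (show j + 1 ≤ c by omega)
  rcases Nat.lt_or_ge j L with hjL | hjL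
  · have h0 : ∑ n ∈ Finset.range j, blockBid L p 0 n = 0 := Finset.sum_eq_zero fun n hn => by
      have := Finset.mem_range.1 hn
      rw [blockBid_zero_apply, if_neg (by omega)]
    rw [h0, blockBid_zero_apply, if_neg (by omega), blockBid_zero_apply] at hstep
    refine ⟨?_, fun h1 h2 => ?_⟩
    · split_ifs at hstep
      · have : 0 ≤ ((c : ℝ) - j - 1) * ((p : ℝ) - L)⁻¹ := mul_nonneg (by linarith) hμ.le
        linarith
      · linarith
    · rw [if_pos ⟨h1, h2⟩] at hstep
      have hjc' : (j : ℝ) + 1 < c := by exact_mod_cast (show j + 1 < c by omega)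
      have : 0 < ((c : ℝ) - j - 1) * ((p : ℝ) - L)⁻¹ := mul_pos (by linarith) hμ
      linarith
  · rw [sum_range_blockBid 0 hjL hj.le, blockBid_zero_apply, if_pos ⟨hjL, hj⟩,
      blockBid_zero_apply] at hstep
    simp only [mul_zero, sub_zero, zero_add, one_div] at hstep
    rcases Nat.lt_or_ge (j + 1) p with h1 | h1
    · rw [if_pos ⟨by omega, h1⟩] at hstep
      have h2 : (3 : ℝ) * j + 2 < 2 * c + L := by exact_mod_cast (show 3 * j + 2 < 2 * c + L by omega)
      have : 0 < (2 * (c : ℝ) + L - 3 * j - 2) * ((p : ℝ) - L)⁻¹ := mul_pos (by linarith) hμ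
      exact ⟨by linarith, fun _ _ => by linarith⟩
    · rw [if_neg (by omega)] at hstep
      have h2 : (2 : ℝ) * j + 1 ≤ c + L := by exact_mod_cast (show 2 * j + 1 ≤ c + L by omega)
      have : 0 ≤ ((c : ℝ) + L - 2 * j - 1) * ((p : ℝ) - L)⁻¹ := mul_nonneg (by linarith) hμ.le
      exact ⟨by linarith, fun _ h => by omega⟩

theorem blockBid_zero_le (hL : L < p) (hpc : p ≤ c) (hpN : p < N) (hLc : 2 * p ≤ c + 1 + L)
    {i j : ℕ} (hij : i ≤ j) (hj : j ≤ p) :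
    bidPayoff N c (blockBid L p 0) i ≤ bidPayoff N c (blockBid L p 0) j := by
  induction j, hij using Nat.le_induction with
  | base => exact le_rfl
  | succ j _ ih => exact (ih (by omega)).trans (blockBid_zero_step hL hpc hpN hLc (by omega)).1

theorem blockBid_zero_lt (hL : L < p) (hpc : p ≤ c) (hpN : p < N) (hLc : 2 * p ≤ c + 1 + L)
    {i j : ℕ} (hij : i < j) (hLj : L ≤ j) (hj : j < p) :
    bidPayoff N c (blockBid L p 0) i < bidPayoff N c (blockBid L p 0) j := by
  obtain ⟨x, rfl⟩ : ∃ x, j = x + 1 := ⟨j - 1, by omega⟩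
  exact (blockBid_zero_le hL hpc hpN hLc (by omega) (by omega)).trans_lt
    ((blockBid_zero_step hL hpc hpN hLc (by omega)).2 hLj hj)

theorem tendsto_blockBid (n : ℕ) :
    Tendsto (fun ε => blockBid L p ε n) (𝓝[>] 0) (𝓝 (blockBid L p 0 n)) := by
  have : Continuous fun ε => blockBid L p ε n := by
    unfold blockBid
    split_ifs <;> fun_prop
  exact (this.tendsto 0).mono_left nhdsWithin_le_nhds

/-- The increment is `(c + L + 1 - 2 * p)` times the block probability plus `(c - p - L) * ε`. In
the boundary case the first term vanishes and the tremble decides. -/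
theorem blockBid_last_step (hL : L < p) (hpN : p < N)
    (hLc : 2 * p < c + 1 + L ∨ 2 * p = c + 1 + L ∧ L + p < c) :
    ∀ᶠ ε in 𝓝[>] 0,
      bidPayoff N c (blockBid L p ε) (p - 1) < bidPayoff N c (blockBid L p ε) p := by
  obtain ⟨P, rfl⟩ : ∃ P, p = P + 1 := ⟨p - 1, by omega⟩
  have hL' : (L : ℝ) < (P + 1 : ℕ) := by exact_mod_cast hL
  have key : ∀ᶠ ε : ℝ in 𝓝[>] 0,
      0 < (c + L - 2 * P - 1) * ((1 - (L + 1) * ε) / (((P + 1 : ℕ) : ℝ) - L)) +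
        (c - P - 1 - L) * ε := by
    rcases hLc with h | ⟨h, h'⟩
    · have h1 : (2 : ℝ) * (P + 1) < c + 1 + L := by exact_mod_cast h
      have hc : ContinuousAt (fun ε : ℝ => ((c : ℝ) + L - 2 * P - 1) *
        ((1 - (L + 1) * ε) / (((P + 1 : ℕ) : ℝ) - L)) + (c - P - 1 - L) * ε) 0 := by fun_prop
      refine nhdsWithin_le_nhds (hc.eventually (lt_mem_nhds ?_))
      simp only [mul_zero, sub_zero, add_zero]
      exact mul_pos (by linarith) (div_pos one_pos (by linarith))
    · have h1 : (2 : ℝ) * (P + 1) = c + 1 + L := by exact_mod_cast h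
      have h2 : (L : ℝ) + (P + 1) < c := by exact_mod_cast h'
      filter_upwards [self_mem_nhdsWithin] with ε hε
      have h3 : (c : ℝ) + L - 2 * P - 1 = 0 := by linarith
      rw [h3, zero_mul, zero_add]
      exact mul_pos (by linarith) hε
  filter_upwards [key] with ε hε
  have hstep := bidPayoff_succ_sub (c : ℝ) (blockBid L (P + 1) ε) hpN
  have e1 : blockBid L (P + 1) ε P = (1 - (L + 1) * ε) / (((P + 1 : ℕ) : ℝ) - L) := by
    rw [blockBid, if_neg (by omega), if_pos (by omega)]
  have e2 : blockBid L (P + 1) ε (P + 1) = ε := if_pos (Or.inr rfl)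
  rw [sum_range_blockBid ε (by omega) (by omega), e1, e2] at hstep
  rw [Nat.add_sub_cancel]
  linarith

theorem eventually_blockBid_high (hL : L < p) (hpc : p ≤ c) (hpN : p < N)
    (hLc : 2 * p < c + 1 + L ∨ 2 * p = c + 1 + L ∧ L + p < c) :
    ∀ᶠ ε in 𝓝[>] 0,
      (∀ b < N, b ≠ p → bidPayoff N c (blockBid L p ε) b < bidPayoff N c (blockBid L p ε) p) ∧
      ∀ d < L, ∀ e, L ≤ e → e < p →
        bidPayoff N c (blockBid L p ε) d < bidPayoff N c (blockBid L p ε) e := by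
  have hLc' : 2 * p ≤ c + 1 + L := by omega
  have hlim : ∀ i j, bidPayoff N c (blockBid L p 0) i < bidPayoff N c (blockBid L p 0) j →
      ∀ᶠ ε in 𝓝[>] 0, bidPayoff N c (blockBid L p ε) i < bidPayoff N c (blockBid L p ε) j :=
    fun i j hij => (tendsto_bidPayoff tendsto_blockBid i).eventually_lt
      (tendsto_bidPayoff tendsto_blockBid j) hij
  have h1 : ∀ᶠ ε in 𝓝[>] 0, ∀ b ∈ Finset.range N, b ≠ p →
      bidPayoff N c (blockBid L p ε) b < bidPayoff N c (blockBid L p ε) p := by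
    simp only [Finset.eventually_all, eventually_imp_distrib_left]
    intro b hb hbp
    rcases lt_trichotomy b (p - 1) with h | rfl | h
    · exact hlim _ _ ((blockBid_zero_lt hL hpc hpN hLc' h (by omega) (by omega)).trans_le
        (blockBid_zero_le hL hpc hpN hLc' (by omega) le_rfl))
    · exact blockBid_last_step hL hpN hLc
    · refine hlim _ _ ?_
      have hlot := isLottery_blockBid hL hpN le_rfl (by simp)
      have hsupp : ∀ n, p ≤ n → blockBid L p 0 n = 0 := fun n hn => by
        rw [blockBid_zero_apply, if_neg (by omega)]
      rw [bidPayoff_of_support_lt hlot hsupp _ le_rfl,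
        bidPayoff_of_support_lt hlot hsupp _ (show p ≤ b by omega)]
      have : (p : ℝ) < b := by exact_mod_cast (show p < b by omega)
      linarith
  have h2 : ∀ᶠ ε in 𝓝[>] 0, ∀ d ∈ Finset.range L, ∀ e ∈ Finset.Ico L p,
      bidPayoff N c (blockBid L p ε) d < bidPayoff N c (blockBid L p ε) e := by
    simp only [Finset.eventually_all]
    intro d hd e he
    rw [Finset.mem_range] at hd
    rw [Finset.mem_Ico] at he
    exact hlim _ _ (blockBid_zero_lt hL hpc hpN hLc' (by omega) he.1 he.2)
  filter_upwards [h1, h2] with ε h1 h2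
  exact ⟨fun b hb => h1 b (Finset.mem_range.2 hb), fun d hd e he he' =>
    h2 d (Finset.mem_range.2 hd) e (Finset.mem_Ico.2 ⟨he, he'⟩)⟩

end HighPayoff

/-- Against bids spread over a set that contains `{L, ..., p - 1}` and no bid below `L`, the bids in
`{L, ..., p - 1}` do better than lower bids. -/
theorem payoffOn_sub {N L p : ℕ} (w : ℝ) {H : Finset ℕ} (hH : H ⊆ Finset.range N) (hpN : p < N)
    (hHL : ∀ n < L, n ∉ H) (hHp : ∀ n, L ≤ n → n < p → n ∈ H) {n k : ℕ} (hn : n < L)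
    (hk : L + k < p) :
    payoffOn w H (L + k) - payoffOn w H n =
      (2 * k + 1) * (w - L - k) + k * (k + 1) / 2 := by
  simp only [← bidPayoff_indicator hH]
  have hlow : ∀ b, n ≤ b → b < L → bidPayoff N w (fun n => if n ∈ H then 1 else 0) b =
      bidPayoff N w (fun n => if n ∈ H then 1 else 0) n := by
    intro b hb
    induction b, hb using Nat.le_induction with
    | base => exact fun _ => rfl
    | succ b hb ih =>
      intro hbL
      rw [← ih (by omega), ← sub_eq_zero, bidPayoff_succ_sub _ _ (by omega),
        Finset.sum_eq_zero fun i hi => if_neg (hHL i (by have := Finset.mem_range.1 hi; omega)),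
        if_neg (hHL b (by omega)), if_neg (hHL (b + 1) hbL)]
      ring
  have hsum : ∀ k, L + k ≤ p →
      ∑ i ∈ Finset.range (L + k), (if i ∈ H then (1 : ℝ) else 0) = k := by
    intro k hk
    rw [Finset.sum_range_add, Finset.sum_eq_zero fun i hi => if_neg (hHL i (Finset.mem_range.1 hi)),
      Finset.sum_congr rfl fun i hi =>
        if_pos (hHp (L + i) (by omega) (by have := Finset.mem_range.1 hi; omega))]
    simp
  induction k with
  | zero =>
    obtain ⟨x, rfl⟩ : ∃ x, L = x + 1 := ⟨L - 1, by omega⟩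
    have h1 := bidPayoff_succ_sub w (fun n => if n ∈ H then (1 : ℝ) else 0)
      (show x + 1 < N by omega)
    rw [hlow x (by omega) (by omega),
      Finset.sum_eq_zero fun i hi => if_neg (hHL i (by have := Finset.mem_range.1 hi; omega)),
      if_neg (hHL x (by omega)), if_pos (hHp (x + 1) le_rfl (by omega))] at h1
    rw [add_zero, h1]
    push_cast
    ring
  | succ k ih =>
    have h1 := bidPayoff_succ_sub w (fun n => if n ∈ H then (1 : ℝ) else 0)
      (show L + k + 1 < N by omega)
    rw [hsum k (by omega), if_pos (hHp (L + k) (by omega) (by omega)),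
      if_pos (hHp (L + k + 1) (by omega) (by omega))] at h1
    have h2 := ih (by omega)
    rw [← add_assoc]
    push_cast at h1 ⊢
    linarith

/-- At `w = m + 1` ties are neutral, so overbidding by one only costs against lower bids. This
breaks the tie between `p - 1` and `p` when `p = a`. -/
theorem bidUtility_sub_succ {w : ℝ} {m : ℕ} (hw : w = m + 1) (d : ℕ) :
    bidUtility w m d - bidUtility w (m + 1) d = if d < m then 1 else 0 := by
  unfold bidUtility
  rcases lt_trichotomy d m with h | rfl | h
  · rw [if_pos h, if_pos (by omega), if_pos h]
    push_cast
    ring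
  · simp [hw]
    ring
  · rcases Nat.lt_or_ge (m + 1) d with h' | h'
    · rw [if_neg (by omega), if_neg (by omega), if_neg (by omega), if_neg (by omega),
        if_neg (by omega), sub_self]
    · obtain rfl : d = m + 1 := by omega
      simp [hw]

/-! ### Empirical equilibria with a block of bids -/

section Sufficiency

variable {N a c L p : ℕ}

theorem blockBid_mem_closure_monotonePairs {ε : ℝ} (hL : L < p) (hap : a ≤ p) (hpN : p < N)
    (hV : ∀ k, 0 < L → L + k < p → 0 < (2 * (k : ℝ) + 1) * (a - L - k) + k * (k + 1) / 2)
    (hpa : a < p ∨ L + 1 = p ∧ 0 < L) (hε : 0 < ε) (hε' : (L + 1) * ε ≤ 1)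
    (hεμ : ε < (1 - (L + 1) * ε) / ((p : ℝ) - L))
    (hbest : ∀ b < N, b ≠ p → bidPayoff N c (blockBid L p ε) b < bidPayoff N c (blockBid L p ε) p)
    (hblock : ∀ d < L, ∀ e, L ≤ e → e < p →
      bidPayoff N c (blockBid L p ε) d < bidPayoff N c (blockBid L p ε) e) :
    (Pi.single p 1, blockBid L p ε) ∈ closure (monotonePairs N a c) := by
  classical
  -- `H` collects the bids other than `p` that beat every bid below `L`. It contains the block, and
  -- the bids below `L` fall in `R`; bids above `p` are sorted by their payoffs.
  set r := blockBid L p ε with hr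
  set H := (Finset.range N).filter fun b =>
    b ≠ p ∧ ∀ d < L, bidPayoff N c r d < bidPayoff N c r b with hH
  set R := (Finset.range N).filter fun b =>
    b ≠ p ∧ ∃ d < L, bidPayoff N c r b ≤ bidPayoff N c r d with hR
  have hap' : (a : ℝ) ≤ p := by exact_mod_cast hap
  have hHL : ∀ n < L, n ∉ H := fun n hn h => by
    simp only [hH, Finset.mem_filter] at h
    exact lt_irrefl _ (h.2.2 n hn)
  have hHp : ∀ n, L ≤ n → n < p → n ∈ H := fun n hn hn' => by
    simp only [hH, Finset.mem_filter, Finset.mem_range]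
    exact ⟨by omega, by omega, fun d hd => hblock d hd n hn hn'⟩
  refine single_mem_closure_monotonePairs (H := H) (R := R)
    (isLottery_blockBid hL hpN hε.le hε') hpN hbest (Finset.filter_subset _ _)
    (Finset.filter_subset _ _) (by simp [hH]) (by simp [hR]) ?_ ?_ ?_ ?_
  · rw [Finset.disjoint_left]
    intro b hb hb'
    simp only [hH, hR, Finset.mem_filter] at hb hb'
    obtain ⟨d, hd, hle⟩ := hb'.2.2
    exact hle.not_gt (hb.2.2 d hd)
  · intro b hb hbp
    by_cases h : ∀ d < L, bidPayoff N c r d < bidPayoff N c r b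
    · exact Or.inl (Finset.mem_filter.2 ⟨Finset.mem_range.2 hb, hbp, h⟩)
    · push Not at h
      exact Or.inr (Finset.mem_filter.2 ⟨Finset.mem_range.2 hb, hbp, h⟩)
  · intro m hm n hn
    simp only [hH, hR, Finset.mem_filter] at hm hn
    obtain ⟨d, hd, hle⟩ := hn.2.2
    exact hle.trans_lt (hm.2.2 d hd)
  · intro m hm n hn hmn
    have hlow : ∀ b, b < L ∨ b = p → r b = ε := fun b hb => if_pos hb
    have hmid : ∀ b, L ≤ b → b < p → r b = (1 - (L + 1) * ε) / ((p : ℝ) - L) := fun b hb hb' => by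
      rw [hr, blockBid, if_neg (by omega), if_pos hb']
    have hhigh : ∀ b, p < b → r b = 0 := fun b hb => by
      rw [hr, blockBid, if_neg (by omega), if_neg (by omega)]
    have ubelow : ∀ b, b < p → bidUtility a b p = p := fun b hb => by
      rw [bidUtility, if_neg (by omega), if_neg (by omega)]
    have uabove : ∀ b, p < b → bidUtility a b p = 2 * a - b := fun b hb => by
      rw [bidUtility, if_pos hb]
    have ueq : bidUtility a p p = a := by
      rw [bidUtility, if_neg (lt_irrefl _), if_pos rfl]
    rcases lt_trichotomy n p with hnp | hnp | hnp
    · rcases Nat.lt_or_ge n L with hnL | hnL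
      · rcases lt_trichotomy m p with hmp | hmp | hmp
        · rcases Nat.lt_or_ge m L with hmL | hmL
          · rw [hlow n (Or.inl hnL), hlow m (Or.inl hmL)] at hmn
            exact absurd hmn (lt_irrefl _)
          · obtain ⟨k, rfl⟩ := Nat.exists_eq_add_of_le hmL
            refine Or.inr ⟨by rw [ubelow _ hmp, ubelow _ hnp, sub_self], Or.inl ?_⟩
            rw [payoffOn_sub (a : ℝ) (Finset.filter_subset _ _) hpN hHL hHp hnL hmp]
            exact hV k (by omega) hmp
        · rw [hlow n (Or.inl hnL), hlow m (Or.inr hmp)] at hmn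
          exact absurd hmn (lt_irrefl _)
        · rw [hlow n (Or.inl hnL), hhigh m hmp] at hmn
          linarith
      · rw [hmid n hnL hnp] at hmn
        rcases lt_trichotomy m p with hmp | hmp | hmp
        · rcases Nat.lt_or_ge m L with hmL | hmL
          · rw [hlow m (Or.inl hmL)] at hmn
            linarith
          · rw [hmid m hmL hmp] at hmn
            exact absurd hmn (lt_irrefl _)
        · rw [hlow m (Or.inr hmp)] at hmn
          linarith
        · rw [hhigh m hmp] at hmn
          linarith
    · rw [hlow n (Or.inr hnp)] at hmn
      rcases lt_trichotomy m p with hmp | hmp | hmp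
      · have hmL : L ≤ m := by
          by_contra h
          rw [hlow m (Or.inl (not_le.1 h))] at hmn
          exact lt_irrefl _ hmn
        rw [hnp, ubelow m hmp, ueq]
        rcases hpa with h | ⟨h, h0⟩
        · have : (a : ℝ) < p := by exact_mod_cast h
          exact Or.inl (by linarith)
        · rcases hap.eq_or_lt with h' | h'
          · obtain rfl : m = L := by omega
            have hpm : (p : ℝ) = m + 1 := by exact_mod_cast h.symm
            have ham : (a : ℝ) = m + 1 := by rw [← hpm, h']
            -- At `p = a` the bids `p - 1` and `p` tie against `p` and against `H`, which has no bid
            -- below `L`. The bid 0 in `R` decides.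
            refine Or.inr ⟨by linarith, Or.inr ⟨?_, ?_⟩⟩
            · rw [payoffOn, payoffOn, ← Finset.sum_sub_distrib]
              refine Finset.sum_eq_zero fun d hd => ?_
              rw [← h, bidUtility_sub_succ ham, if_neg fun hlt => hHL d hlt hd]
            · rw [payoffOn, payoffOn, ← Finset.sum_sub_distrib]
              refine Finset.sum_pos' (fun d _ => ?_) ⟨0, ?_, ?_⟩
              · rw [← h, bidUtility_sub_succ ham]
                split_ifs <;> norm_num
              · exact Finset.mem_filter.2 ⟨Finset.mem_range.2 (by omega), by omega, 0, h0, le_rfl⟩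
              · rw [← h, bidUtility_sub_succ ham, if_pos h0]
                exact one_pos
          · have : (a : ℝ) < p := by exact_mod_cast h'
            exact Or.inl (by linarith)
      · rw [hlow m (Or.inr hmp)] at hmn
        exact absurd hmn (lt_irrefl _)
      · rw [hhigh m hmp] at hmn
        linarith
    · left
      rw [uabove n hnp]
      have hn' : (p : ℝ) < n := by exact_mod_cast hnp
      rcases lt_trichotomy m p with hmp | rfl | hmp
      · rw [ubelow m hmp]
        linarith
      · rw [ueq]
        linarith
      · rw [hhigh m hmp, hhigh n hnp] at hmn
        exact absurd hmn (lt_irrefl _)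

theorem blockBid_zero_mem_closure (hL : L < p) (hap : a ≤ p) (hpc : p ≤ c) (hpN : p < N)
    (hLc : 2 * p < c + 1 + L ∨ 2 * p = c + 1 + L ∧ L + p < c)
    (hV : ∀ k, 0 < L → L + k < p → 0 < (2 * (k : ℝ) + 1) * (a - L - k) + k * (k + 1) / 2)
    (hpa : a < p ∨ L + 1 = p ∧ 0 < L) :
    (Pi.single p 1, blockBid L p 0) ∈ closure (monotonePairs N a c) := by
  -- Two limits in succession: the high agent's trembles vanish for fixed `ε`, then `ε` tends to 0.
  rw [← closure_closure]
  have hL' : (L : ℝ) < p := by exact_mod_cast hL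
  have hten : Tendsto (fun ε : ℝ => ((Pi.single p 1 : ℕ → ℝ), blockBid L p ε)) (𝓝[>] 0)
      (𝓝 (Pi.single p 1, blockBid L p 0)) :=
    tendsto_const_nhds.prodMk_nhds (tendsto_pi_nhds.2 tendsto_blockBid)
  have h1 : ∀ᶠ ε : ℝ in 𝓝[>] 0, (L + 1) * ε < 1 := by
    have hc : ContinuousAt (fun ε : ℝ => ((L : ℝ) + 1) * ε) 0 := by fun_prop
    exact nhdsWithin_le_nhds (hc.eventually (gt_mem_nhds (by simp)))
  have h2 : ∀ᶠ ε : ℝ in 𝓝[>] 0, 0 < (1 - (L + 1) * ε) / ((p : ℝ) - L) - ε := by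
    have hc : ContinuousAt (fun ε : ℝ => (1 - (L + 1) * ε) / ((p : ℝ) - L) - ε) 0 := by fun_prop
    refine nhdsWithin_le_nhds (hc.eventually (lt_mem_nhds ?_))
    simpa using hL'
  refine mem_closure_of_tendsto hten ?_
  filter_upwards [h1, h2, eventually_blockBid_high hL hpc hpN hLc, self_mem_nhdsWithin]
    with ε h1 h2 h3 h4
  exact blockBid_mem_closure_monotonePairs hL hap hpN hV hpa h4 h1.le (by linarith) h3.1 h3.2

theorem isPriceEquilibrium_blockBid_zero (hL : L < p) (hap : a ≤ p) (hpc : p ≤ c) (hpN : p < N)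
    (hLc : 2 * p ≤ c + 1 + L) :
    IsPriceEquilibrium N a c p (Pi.single p 1) (blockBid L p 0) := by
  have hL' : (L : ℝ) < p := by exact_mod_cast hL
  refine ⟨hpN, by omega, hap, hpc, rfl, fun n hn => ?_, isLottery_blockBid hL hpN le_rfl (by simp),
    ?_⟩
  · rw [blockBid_zero_apply, if_neg (by omega)]
  · rw [blockBid_zero_apply, if_pos (by omega), ← div_eq_mul_inv, one_le_div (by linarith)]
    have : (2 : ℝ) * p ≤ c + 1 + L := by exact_mod_cast hLc
    linarith

theorem isBestResponse_blockBid_zero (hap : a ≤ p) (hpN : p < N) :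
    IsBestResponse N a (blockBid L p 0) (Pi.single p 1) := by
  intro m hm hpos n hn
  have hap' : (a : ℝ) ≤ p := by exact_mod_cast hap
  have hmp : m < p := by
    by_contra h
    rw [blockBid_zero_apply, if_neg (by omega)] at hpos
    exact lt_irrefl _ hpos
  rw [bidPayoff_single hpN, bidPayoff_single hpN, bidUtility, bidUtility,
    if_neg (show ¬ p < m by omega), if_neg (show m ≠ p by omega)]
  split_ifs with h1 h2
  · have : (p : ℝ) < n := by exact_mod_cast h1
    linarith
  · exact hap'
  · exact le_rfl

theorem isBestResponse_single (hL : L < p) (hap : a ≤ p) (hpc : p ≤ c) (hpN : p < N)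
    (hLc : 2 * p ≤ c + 1 + L) : IsBestResponse N c (Pi.single p 1) (blockBid L p 0) := by
  intro m hm hpos n hn
  have hmp : m = p := by
    by_contra h
    simp [h] at hpos
  subst hmp
  have h := isPriceEquilibrium_blockBid_zero hL hap hpc hpN hLc
  rcases Nat.le_total n m with hnm | hnm
  · exact blockBid_zero_le hL hpc hpN hLc hnm le_rfl
  · rw [bidPayoff_of_support_lt h.low_lottery h.low_eq_zero _ le_rfl,
      bidPayoff_of_support_lt h.low_lottery h.low_eq_zero _ hnm]
    have : (m : ℝ) ≤ n := by exact_mod_cast hnm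
    linarith

/-- The lower end of the support of the low value agent's bids at the price `p`. -/
theorem exists_lower_end (ha : 2 ≤ a) (hac : a < c) (hap : a ≤ p)
    (h : (c ≤ a + 2 → p = a) ∧ (a + 2 < c → 8 * a ≤ 3 * c → 2 * p ≤ c + 1) ∧
      (a + 2 < c → 3 * c < 8 * a → 5 * p ≤ c + 4 * a + 4) ∧
      (a + 2 < c → 3 * c < 8 * a → 7 * (c - 1) ≤ 12 * a → 5 * p < c + 4 * a + 4)) :
    ∃ L < p, (2 * p < c + 1 + L ∨ 2 * p = c + 1 + L ∧ L + p < c) ∧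
      (∀ k : ℕ, 0 < L → L + k < p → 0 < (2 * (k : ℝ) + 1) * (a - L - k) + k * (k + 1) / 2) ∧
      (a < p ∨ L + 1 = p ∧ 0 < L) := by
  obtain ⟨h1, h2, h3, h4⟩ := h
  rcases hap.eq_or_lt with rfl | hap
  · refine ⟨a - 1, by omega, by omega, fun k _ hk => ?_, by omega⟩
    obtain rfl : k = 0 := by omega
    rw [Nat.cast_sub (by omega)]
    norm_num
  rcases Nat.lt_or_ge (c + 1) (2 * p) with hpc | hpc
  swap
  -- With `L = 0` no bid lies below the block, so the low agent's condition is vacuous.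
  · exact ⟨0, by omega, by omega, fun k h => absurd h (lt_irrefl 0), Or.inl hap⟩
  have hca : a + 2 < c := by
    by_contra h
    have := h1 (by omega)
    omega
  have hca' : 3 * c < 8 * a := by
    by_contra h
    have := h2 hca (by omega)
    omega
  have h3 := h3 hca hca'
  have h4 := h4 hca hca'
  obtain ⟨D, rfl⟩ : ∃ D, p = a + D + 1 := ⟨p - a - 1, by omega⟩
  rcases Nat.eq_zero_or_pos D with rfl | hD
  · refine ⟨a - 1, by omega, by omega, fun k _ hk => ?_, Or.inl hap⟩
    obtain rfl | rfl : k = 0 ∨ k = 1 := by omega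
    all_goals
      rw [Nat.cast_sub (by omega)]
      norm_num
  -- The block `{a - 3 * D, ..., a + D}` has the `4 * D + 1` bids of the necessity argument. The
  -- price bound and `c + 1 < 2 * p` give `3 * D < a`, so the subtraction is not truncated.
  · refine ⟨a - 3 * D, by omega, by omega, fun k _ hk => ?_, Or.inl hap⟩
    have hk' : (k : ℝ) ≤ 4 * D := by exact_mod_cast (show k ≤ 4 * D by omega)
    have hk0 : (0 : ℝ) ≤ k := Nat.cast_nonneg k
    have hD' : (0 : ℝ) < D := by exact_mod_cast hD
    rw [Nat.cast_sub (by omega)]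
    push_cast
    -- The expression is concave in `k`, with values `3 * D` at `k = 0` and `D` at `k = 4 * D`.
    -- Scaled by `4 * D`, it is the chord plus a multiple of `k * (4 * D - k)`.
    have key : 0 < 4 * (D : ℝ) *
        ((2 * (k : ℝ) + 1) * (a - (a - 3 * D) - k) + k * (k + 1) / 2) := by
      have e : 4 * (D : ℝ) * ((2 * (k : ℝ) + 1) * (a - (a - 3 * D) - k) + k * (k + 1) / 2) =
          (4 * D - k) * (3 * D) + k * D + 3 / 2 * (4 * D) * (k * (4 * D - k)) := by ring
      rw [e]
      have e1 : 0 ≤ 3 / 2 * (4 * (D : ℝ)) * (k * (4 * D - k)) :=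
        mul_nonneg (by positivity) (mul_nonneg hk0 (by linarith))
      nlinarith [mul_nonneg hk0 hD'.le, mul_nonneg (sub_nonneg.2 hk') hD'.le, mul_pos hD' hD']
    exact (mul_pos_iff_of_pos_left (by positivity)).1 key

end Sufficiency

/-! ### Empirical equilibria of the winner-bid auction -/

/-- The extension by zero of a strategy to all natural numbers. -/
noncomputable def extendBid {pbar : ℕ} (x : Bid pbar → ℝ) : ℕ → ℝ := Function.extend Fin.val x 0

theorem apply_eq_extendBid {pbar : ℕ} (x : Bid pbar → ℝ) (n : Bid pbar) : x n = extendBid x n :=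
  (Fin.val_injective.extend_apply x 0 n).symm

theorem extendBid_of_le {pbar : ℕ} (x : Bid pbar → ℝ) {n : ℕ} (hn : pbar + 1 ≤ n) :
    extendBid x n = 0 :=
  Function.extend_apply' _ _ _ fun ⟨m, hm⟩ => by
    have := m.2
    omega

theorem extendBid_nonneg {pbar : ℕ} {x : Bid pbar → ℝ} (hx : IsLottery (pbar + 1) (extendBid x))
    (n : ℕ) : 0 ≤ extendBid x n := by
  rcases Nat.lt_or_ge n (pbar + 1) with hn | hn
  exacts [hx.nonneg n hn, (extendBid_of_le x hn).ge]

theorem tendsto_extendBid {pbar : ℕ} {s : ℕ → Bid pbar → ℝ} {x : Bid pbar → ℝ}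
    (hs : Tendsto s atTop (𝓝 x)) (n : ℕ) :
    Tendsto (fun k => extendBid (s k) n) atTop (𝓝 (extendBid x n)) := by
  rcases Nat.lt_or_ge n (pbar + 1) with hn | hn
  · simpa only [← apply_eq_extendBid _ ⟨n, hn⟩] using tendsto_pi_nhds.1 hs ⟨n, hn⟩
  · simp only [extendBid_of_le _ hn]
    exact tendsto_const_nhds

section Auction

variable {pbar : ℕ} {v : Fin 2 → ℕ} {σ : Fin 2 → Bid pbar → ℝ} {l h : Fin 2} {a c p : ℕ}

theorem payoffs_of_isPriceEquilibrium (hlh : l ≠ h) (hl : v l = 2 * a) (hh : v h = 2 * c)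
    {q r : ℕ → ℝ} (hr : ∀ n, σ l n = r n) (hq : ∀ n, σ h n = q n)
    (he : IsPriceEquilibrium (pbar + 1) a c p q r) :
    payoff (winnerBidAuction pbar) v σ l = p ∧
      payoff (winnerBidAuction pbar) v σ h = 2 * c - p := by
  rw [payoff_eq_sum_bidPayoff hlh hl hr hq, payoff_eq_sum_bidPayoff hlh.symm hh hq hr]
  exact ⟨he.low_payoff _, he.high_payoff _⟩

theorem exists_price_of_isNash (hlh : l ≠ h) (hl : v l = 2 * a) (hh : v h = 2 * c) (hac : a < c)
    (hσ : IsNash (winnerBidAuction pbar) v σ)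
    (heff : payoff (winnerBidAuction pbar) v σ l + payoff (winnerBidAuction pbar) v σ h = 2 * c) :
    ∃ p, IsPriceEquilibrium (pbar + 1) a c p (extendBid (σ h)) (extendBid (σ l)) := by
  obtain ⟨⟨hr, hq⟩, h1, h2⟩ := (isNash_iff hlh hl hh (apply_eq_extendBid _)
    (apply_eq_extendBid _)).1 hσ
  rw [payoff_eq_sum_bidPayoff hlh hl (apply_eq_extendBid _) (apply_eq_extendBid _),
    payoff_eq_sum_bidPayoff hlh.symm hh (apply_eq_extendBid _) (apply_eq_extendBid _)] at heff
  exact exists_isPriceEquilibrium hac hq hr (fun n => extendBid_of_le _)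
    (fun n => extendBid_of_le _) h2 h1 heff

theorem exists_isEmpiricalEquilibrium_iff (hlh : l ≠ h) (hl : v l = 2 * a) (hh : v h = 2 * c)
    (ha : 2 ≤ a) (hac : a < c) (hap : a ≤ p) (hpc : p ≤ c) (hpN : p < pbar + 1) :
    (∃ τ : Fin 2 → Bid pbar → ℝ, IsEmpiricalEquilibrium (winnerBidAuction pbar) v τ ∧
      payoff (winnerBidAuction pbar) v τ l = p ∧
        payoff (winnerBidAuction pbar) v τ h = 2 * c - p) ↔
    (c ≤ a + 2 → p = a) ∧ (a + 2 < c → 8 * a ≤ 3 * c → 2 * p ≤ c + 1) ∧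
      (a + 2 < c → 3 * c < 8 * a → 5 * p ≤ c + 4 * a + 4) ∧
      (a + 2 < c → 3 * c < 8 * a → 7 * (c - 1) ≤ 12 * a → 5 * p < c + 4 * a + 4) := by
  constructor
  · rintro ⟨τ, ⟨hτ, s, hs, hlim⟩, hpl, hph⟩
    obtain ⟨p', he⟩ := exists_price_of_isNash hlh hl hh hac hτ (by rw [hpl, hph]; ring)
    have hp' := (payoffs_of_isPriceEquilibrium hlh hl hh (apply_eq_extendBid _)
      (apply_eq_extendBid _) he).1
    obtain rfl : p = p' := by
      rw [hpl] at hp'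
      exact_mod_cast hp'
    have hmono := fun k => (isWeaklyPayoffMonotone_iff hlh hl hh (apply_eq_extendBid _)
      (apply_eq_extendBid _)).1 (hs k)
    have happ : IsMonotoneApproximation (pbar + 1) a c p (fun k => extendBid (s k h))
        (fun k => extendBid (s k l)) (extendBid (τ l)) :=
      { eq := he.high_eq ▸ he
        high_nonneg := fun k => extendBid_nonneg (hmono k).1.2
        low_nonneg := fun k => extendBid_nonneg (hmono k).1.1
        high_mono := fun k => (hmono k).2.2
        low_mono := fun k => (hmono k).2.1
        high_tendsto := fun n => he.high_eq ▸ tendsto_extendBid (tendsto_pi_nhds.1 hlim h) n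
        low_tendsto := fun n => tendsto_extendBid (tendsto_pi_nhds.1 hlim l) n }
    exact happ.price_bounds ha hac
  · intro hbounds
    obtain ⟨L, hL, hLc, hV, hpa⟩ := exists_lower_end ha hac hap hbounds
    have hLc' : 2 * p ≤ c + 1 + L := by omega
    have he := isPriceEquilibrium_blockBid_zero hL hap hpc hpN hLc'
    set prof : (ℕ → ℝ) × (ℕ → ℝ) → Fin 2 → Bid pbar → ℝ :=
      fun x i n => if i = h then x.1 n else x.2 n with hprof
    have hprofh : ∀ x n, prof x h n = x.1 n := fun x n => if_pos rfl
    have hprofl : ∀ x n, prof x l n = x.2 n := fun x n => if_neg hlh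
    have hcont : Continuous prof := by
      refine continuous_pi fun i => continuous_pi fun n => ?_
      simp only [hprof]
      split_ifs <;> fun_prop
    obtain ⟨x, hx, hxlim⟩ := mem_closure_iff_seq_limit.1
      (blockBid_zero_mem_closure hL hap hpc hpN hLc hV hpa)
    refine ⟨prof (Pi.single p 1, blockBid L p 0), ⟨?_, fun k => prof (x k), fun k => ?_,
      (hcont.tendsto _).comp hxlim⟩,
      payoffs_of_isPriceEquilibrium hlh hl hh (hprofl _) (hprofh _) he⟩
    · refine (isNash_iff hlh hl hh (hprofl _) (hprofh _)).2 ⟨⟨he.low_lottery, ?_, ?_⟩,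
        isBestResponse_blockBid_zero hap hpN, isBestResponse_single hL hap hpc hpN hLc'⟩
      · intro n _
        exact (Pi.single_nonneg.2 zero_le_one : (0 : ℕ → ℝ) ≤ Pi.single p 1) n
      · simp [Pi.single_apply, hpN]
    · exact (isWeaklyPayoffMonotone_iff hlh hl hh (hprofl _) (hprofh _)).2 (hx k)

end Auction

end WinnerBid

/-! ### The theorem, translated into integer inequalities on the price -/

theorem theorem1 (vmin vmax pbar : ℕ) (hmin : Even vmin) (hmax : Even vmax)
    (hmin2 : 2 < vmin) (hminmax : vmin ≤ vmax) (hpbar : vmax / 2 + 2 ≤ pbar)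
    (v : Fin 2 → ℕ) (hv : ∀ i, v i ∈ typeSpace vmin vmax)
    (l h : Fin 2) (hlh : v l < v h)
    (σ : Fin 2 → Bid pbar → ℝ) (hσ : IsNash (winnerBidAuction pbar) v σ)
    (heff : IsEfficient (winnerBidAuction pbar) v σ) :
    (∃ τ : Fin 2 → Bid pbar → ℝ, IsEmpiricalEquilibrium (winnerBidAuction pbar) v τ ∧
      ∀ i, payoff (winnerBidAuction pbar) v τ i = payoff (winnerBidAuction pbar) v σ i) ↔
    (equitySurplus (v l) (v h) ≤ 2 →
      payoff (winnerBidAuction pbar) v σ h = (v h : ℝ) / 2 + equitySurplus (v l) (v h)) ∧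
    (2 < equitySurplus (v l) (v h) → (v l : ℝ) ≤ 3 * (v h : ℝ) / 8 →
      payoff (winnerBidAuction pbar) v σ h ≥
        (v h : ℝ) / 2 + equitySurplus (v l) (v h) / 2 + (v l : ℝ) / 4 - 1 / 2) ∧
    (2 < equitySurplus (v l) (v h) → (v l : ℝ) > 3 * (v h : ℝ) / 8 →
      (v l : ℝ) < 7 * (v h : ℝ) / 12 - 7 / 6 →
      payoff (winnerBidAuction pbar) v σ h ≥
        (v h : ℝ) / 2 + 4 * equitySurplus (v l) (v h) / 5 - 4 / 5) ∧
    (2 < equitySurplus (v l) (v h) → (v l : ℝ) > 3 * (v h : ℝ) / 8 →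
      (v l : ℝ) ≥ 7 * (v h : ℝ) / 12 - 7 / 6 →
      payoff (winnerBidAuction pbar) v σ h >
        (v h : ℝ) / 2 + 4 * equitySurplus (v l) (v h) / 5 - 4 / 5) := by
  obtain ⟨a, hl⟩ : ∃ a, v l = 2 * a := by
    obtain ⟨-, k, hk⟩ := hv l
    obtain ⟨m, hm⟩ := hmin
    exact ⟨m + k, by omega⟩
  obtain ⟨c, hh⟩ : ∃ c, v h = 2 * c := by
    obtain ⟨-, k, hk⟩ := hv h
    obtain ⟨m, hm⟩ := hmin
    exact ⟨m + k, by omega⟩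
  have ha : 2 ≤ a := by
    obtain ⟨-, k, hk⟩ := hv l
    omega
  have hac : a < c := by omega
  have hne : l ≠ h := by
    rintro rfl
    exact lt_irrefl _ hlh
  have hsum : payoff (winnerBidAuction pbar) v σ l + payoff (winnerBidAuction pbar) v σ h =
      2 * c := by
    have hcases : (l = 0 ∧ h = 1) ∨ (l = 1 ∧ h = 0) := by omega
    unfold IsEfficient at heff
    rcases hcases with ⟨rfl, rfl⟩ | ⟨rfl, rfl⟩
    · rw [heff, max_eq_right hlh.le, hh]
      push_cast
      rfl
    · rw [add_comm, heff, max_eq_left hlh.le, hh]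
      push_cast
      rfl
  obtain ⟨p, he⟩ := WinnerBid.exists_price_of_isNash hne hl hh hac hσ hsum
  obtain ⟨hpl, hph⟩ := WinnerBid.payoffs_of_isPriceEquilibrium hne hl hh
    (WinnerBid.apply_eq_extendBid _) (WinnerBid.apply_eq_extendBid _) he
  have hiff := WinnerBid.exists_isEmpiricalEquilibrium_iff hne hl hh ha hac he.le_price
    he.price_le he.lt
  simp only [WinnerBid.forall_fin_two_of_ne hne, hpl, hph]
  rw [hiff]
  have hES : equitySurplus (v l) (v h) = c - a := by
    have : (a : ℝ) < c := by exact_mod_cast hac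
    rw [equitySurplus, hl, hh]
    push_cast
    rw [abs_of_pos (by linarith)]
    ring
  rw [hES, hl, hh]
  have e1 : (c : ℝ) - a ≤ 2 ↔ c ≤ a + 2 := by
    rw [sub_le_iff_le_add, add_comm]
    exact_mod_cast Iff.rfl
  have e2 : 2 < (c : ℝ) - a ↔ a + 2 < c := by
    rw [lt_sub_iff_add_lt, add_comm]
    exact_mod_cast Iff.rfl
  have e3 : ((2 * a : ℕ) : ℝ) ≤ 3 * ((2 * c : ℕ) : ℝ) / 8 ↔ 8 * a ≤ 3 * c := by
    rw [← @Nat.cast_le ℝ]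
    push_cast
    constructor <;> intro <;> linarith
  have e4 : ((2 * a : ℕ) : ℝ) > 3 * ((2 * c : ℕ) : ℝ) / 8 ↔ 3 * c < 8 * a := by
    rw [gt_iff_lt, ← not_le, e3, not_le]
  have e5 : ((2 * a : ℕ) : ℝ) ≥ 7 * ((2 * c : ℕ) : ℝ) / 12 - 7 / 6 ↔ 7 * (c - 1) ≤ 12 * a := by
    rw [← @Nat.cast_le ℝ]
    push_cast [show 1 ≤ c by omega]
    constructor <;> intro <;> linarith
  have e6 : ((2 * a : ℕ) : ℝ) < 7 * ((2 * c : ℕ) : ℝ) / 12 - 7 / 6 ↔ ¬ 7 * (c - 1) ≤ 12 * a := by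
    rw [← e5, not_le]
  have f1 : 2 * (c : ℝ) - p = ((2 * c : ℕ) : ℝ) / 2 + (c - a) ↔ p = a := by
    rw [← @Nat.cast_inj ℝ]
    push_cast
    constructor <;> intro <;> linarith
  have f2 : 2 * (c : ℝ) - p ≥ ((2 * c : ℕ) : ℝ) / 2 + (c - a) / 2 + ((2 * a : ℕ) : ℝ) / 4 - 1 / 2 ↔
      2 * p ≤ c + 1 := by
    rw [← @Nat.cast_le ℝ]
    push_cast
    constructor <;> intro <;> linarith
  have f3 : 2 * (c : ℝ) - p ≥ ((2 * c : ℕ) : ℝ) / 2 + 4 * (c - a) / 5 - 4 / 5 ↔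
      5 * p ≤ c + 4 * a + 4 := by
    rw [← @Nat.cast_le ℝ]
    push_cast
    constructor <;> intro <;> linarith
  have f4 : 2 * (c : ℝ) - p > ((2 * c : ℕ) : ℝ) / 2 + 4 * (c - a) / 5 - 4 / 5 ↔
      5 * p < c + 4 * a + 4 := by
    rw [← @Nat.cast_lt ℝ]
    push_cast
    constructor <;> intro <;> linarith
  rw [e1, e2, e3, e4, e5, e6, f1, f2, f3, f4]
  omega
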